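/- Let $0<l_a\le l_b$ be real numbers. For a nondegenerate triangle $ABC$ in the Euclidean plane, with vertices named $A,B,C$, consider the lengths of its internal angle bisectors (measured from the vertex to the opposite side), of its heights $h_a,h_b,h_c$ and of its medians $m_a,m_b,m_c$ from $A,B,C$ respectively. Put $$c^*=\tfrac12\Bigl(l_a+l_b+\sqrt{l_a^2+l_b^2-l_al_b}\Bigr),\qquad a^*=\frac{c^*}{2c^*/l_b-1},\qquad b^*=\frac{c^*}{2c^*/l_a-1},$$ $$h^{**}=\frac{l_al_b}{\sqrt{l_a^2+l_b^2}},\qquad m_a^*=b^*+\tfrac12a^*,\qquad m_b^*=a^*+\tfrac12b^*,\qquad m_c^*=\tfrac12(a^*-b^*).$$ Count, up to congruence, the triangles whose bisectors from $A$ and $B$ have lengths $l_a$ and $l_b$ and in which one further element has a prescribed real value $x$. Here "exactly one" means that there is such a triangle and that any two of them are congruent with $A,B,C$ corresponding to $A,B,C$; "exactly two" means that there are two such triangles that are not congruent under any correspondence of their vertices, and that every other one is congruent to one of these two with $A,B,C$ corresponding to $A,B,C$. 1. $h_a=x$: there are exactly two triangles if $h^{**}<x<l_a$, exactly one if $0<x\le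 h^{**}$ or $x=l_a$, and none if $x\le 0$ or $x>l_a$. 2. $h_b=x$: there are exactly two triangles if $h^{**}<x<l_b$, exactly one if $0<x\le h^{**}$ or $x=l_b$, and none if $x\le 0$ or $x>l_b$. 3. $h_c=x$: there is exactly one triangle if $x>0$, and none if $x\le0$. 4. $m_a=x$: there are exactly two triangles if $l_a<x<m_a^*$, exactly one if $x\ge m_a^*$ or $x=l_a$, and none if $x<l_a$. 5. $m_b=x$: there are exactly two triangles if $l_b<x<m_b^*$, exactly one if $x\ge m_b^*$ or $x=l_b$, and none if $x<l_b$. 6. $m_c=x$: there is exactly one triangle if $x>m_c^*$, and none if $x\le m_c^*$. -/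

import Mathlib

namespace TwoBisectors

/-- Nondegenerate triangles in the Euclidean plane. The vertices `A`, `B`, `C` are the points with
index `0`, `1`, `2`; heights are given by `Affine.Simplex.height`. -/
abbrev PlaneTriangle : Type := Affine.Triangle ℝ (EuclideanSpace ℝ (Fin 2))

/-- `D` is the foot of the internal bisector from vertex `i`: it lies strictly inside the opposite
side, and the line from vertex `i` to `D` halves the angle at vertex `i`. The addition in `Fin 3`
is modulo three, so `i + 1` and `i + 2` are the two other vertices. -/
def IsBisectorFoot (T : PlaneTriangle) (i : Fin 3) (D : EuclideanSpace ℝ (Fin 2)) : Prop :=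
  Sbtw ℝ (T.points (i + 1)) D (T.points (i + 2)) ∧
    EuclideanGeometry.angle (T.points (i + 1)) (T.points i) D =
      EuclideanGeometry.angle D (T.points i) (T.points (i + 2))

/-- The bisector of `T` from vertex `i` has length `l`. -/
def HasBisectorLength (T : PlaneTriangle) (i : Fin 3) (l : ℝ) : Prop :=
  ∃ D, IsBisectorFoot T i D ∧ dist (T.points i) D = l

/-- The length of the median of `T` from vertex `i`. -/
noncomputable def medianLength (T : PlaneTriangle) (i : Fin 3) : ℝ :=
  dist (T.points i) (midpoint ℝ (T.points (i + 1)) (T.points (i + 2)))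

/-- The triangles whose bisectors from `A` and `B` have lengths `la` and `lb`, and in which the
third element `f` has the value `x`. -/
def trianglesWith (la lb : ℝ) (f : PlaneTriangle → ℝ) (x : ℝ) : Set PlaneTriangle :=
  {T | HasBisectorLength T 0 la ∧ HasBisectorLength T 1 lb ∧ f T = x}

/-- Up to congruence, `S` has exactly one triangle (any two triangles of `S` are congruent
with corresponding vertices having the same name). -/
def ExactlyOne (S : Set PlaneTriangle) : Prop :=
  ∃ T₁ ∈ S, ∀ T ∈ S, Congruent T.points T₁.points

/-- Up to congruence, `S` has exactly two triangles: two triangles of `S` are not congruent, even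
if the vertices may be renamed, and every triangle of `S` is congruent to one of the two
with corresponding vertices having the same name. -/
def ExactlyTwo (S : Set PlaneTriangle) : Prop :=
  ∃ T₁ ∈ S, ∃ T₂ ∈ S,
    (∀ σ : Equiv.Perm (Fin 3), ¬ Congruent (T₁.points ∘ σ) T₂.points) ∧
      ∀ T ∈ S, Congruent T.points T₁.points ∨ Congruent T.points T₂.points

/-- `c* = (la + lb + √(la² + lb² - la lb)) / 2`. -/
noncomputable def cStar (la lb : ℝ) : ℝ :=
  (la + lb + Real.sqrt (la ^ 2 + lb ^ 2 - la * lb)) / 2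

/-- `a* = c* / (2 c* / lb - 1)`. -/
noncomputable def aStar (la lb : ℝ) : ℝ :=
  cStar la lb / (2 * cStar la lb / lb - 1)

/-- `b* = c* / (2 c* / la - 1)`. -/
noncomputable def bStar (la lb : ℝ) : ℝ :=
  cStar la lb / (2 * cStar la lb / la - 1)

/-- The common value `h** = la lb / √(la² + lb²)` of `h_a**` and `h_b**`. -/
noncomputable def hStarStar (la lb : ℝ) : ℝ :=
  la * lb / Real.sqrt (la ^ 2 + lb ^ 2)

/-- `m_a* = b* + a* / 2`. -/
noncomputable def maStar (la lb : ℝ) : ℝ :=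
  bStar la lb + aStar la lb / 2

/-- `m_b* = a* + b* / 2`. -/
noncomputable def mbStar (la lb : ℝ) : ℝ :=
  aStar la lb + bStar la lb / 2

/-- `m_c* = (a* - b*) / 2`. -/
noncomputable def mcStar (la lb : ℝ) : ℝ :=
  (aStar la lb - bStar la lb) / 2

end TwoBisectors

/-! Let `p` be the semiperimeter, `s = (p - c) / p = tan(A/2) tan(B/2)` and `r = (p - a) / (p - b) =
tan(B/2) / tan(A/2)`. These two numbers fix the shape of a triangle, and `ratioA`, `ratioB` express
the squares of the two bisectors in units of `c`. For fixed `s`, `ratioA` increases and `ratioB`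
decreases in `r`, so exactly one `r s` makes the bisectors proportional to `la : lb`; the scale then
fixes `c`. Hence the triangles with the two given bisectors form a curve with parameter `s` in `(0,
1)`. Its ends are degenerate: at `s = 0` the vertex `C` lies on `AB`, and as `s` tends to `1` it
goes to infinity. The starred constants come from these ends.

Along the curve everything needed is monotone. The side `c` decreases (`strictAntiOn_sideC`);
`tan²(B/2) = s * r s` and, by symmetry, `tan²(A/2) = s / r s` increase (`strictMonoOn_mul`, resting
on `ratio_mul_lt`); and `a`, `b` increase to infinity (`strictMonoOn_sideA`, `tendsto_sideA`).

The six counts follow. The height from `A` is `la * sin (A/2 + B)`, where the angle increases from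
`0` to a value strictly between `π/2` and `π`; so it rises from `0` to `la` and then falls towards
`h**`. The median from `A` satisfies `4 m² = 4 la² + (b - c)² + la² (b - c)² / (b c)`, where `b`
increases past the decreasing `c`; so it falls from its value at `s = 0` to `la` and then rises to
infinity. Exchanging `A` and `B` replaces `r` by `r⁻¹` and settles the elements at `B`. The height
and the median from `C` are strictly increasing and unbounded. -/

open Set Filter Topology

namespace TwoBisectors

/-! ### The bisector-to-side ratios as functions of the shape -/

/-- The square of the ratio of the bisector from `A` to the side `c`, in a triangle with
semiperimeter `p`, `r = (p - a) / (p - b)` and `s = (p - c) / p`. -/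
noncomputable def ratioA (r s : ℝ) : ℝ := 4 * r * (r + s) / (1 + (2 - s) * r) ^ 2

/-- The square of the ratio of the bisector from `B` to the side `c`. -/
noncomputable def ratioB (r s : ℝ) : ℝ := 4 * (1 + r * s) / (2 - s + r) ^ 2

lemma ratioA_inv {r s : ℝ} (hr : 0 < r) (hs : s ∈ Icc (0 : ℝ) 1) :
    ratioA r⁻¹ s = ratioB r s := by
  have h1 : 0 < 2 - s + r := by linarith [hs.2]
  have h2 : 0 < 1 + (2 - s) * r⁻¹ := by
    have : 0 < 2 - s := by linarith [hs.2]
    positivity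
  have h3 : 1 + (2 - s) * r⁻¹ = (2 - s + r) / r := by field_simp; ring
  rw [ratioA, ratioB, h3]
  field_simp

lemma ratioB_inv {r s : ℝ} (hr : 0 < r) (hs : s ∈ Icc (0 : ℝ) 1) :
    ratioB r⁻¹ s = ratioA r s := by
  rw [← ratioA_inv (inv_pos.2 hr) hs, inv_inv]

lemma ratioA_pos {r s : ℝ} (hr : 0 < r) (hs : s ∈ Icc (0 : ℝ) 1) : 0 < ratioA r s := by
  have h0 := hs.1
  have h1 : 0 < 2 - s := by linarith [hs.2]
  unfold ratioA
  positivity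

lemma ratioB_pos {r s : ℝ} (hr : 0 < r) (hs : s ∈ Icc (0 : ℝ) 1) : 0 < ratioB r s := by
  rw [← ratioA_inv hr hs]
  exact ratioA_pos (inv_pos.2 hr) hs

/-- With `k = 2 - s`, the ratio is `4` times the product of `r / (1 + k r)` and `(r + s) / (1 + k
r)`. The first factor is strictly increasing; the second is nondecreasing because `1 - k s = (1 -
s)²`. -/
lemma ratioA_lt_left {r r' s : ℝ} (hr : 0 < r) (hrr : r < r') (hs : s ∈ Icc (0 : ℝ) 1) :
    ratioA r s < ratioA r' s := by
  obtain ⟨h0, h1⟩ := hs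
  have hk : 0 < 2 - s := by linarith
  have hr' : 0 < r' := hr.trans hrr
  unfold ratioA
  rw [div_lt_div_iff₀ (by positivity) (by positivity)]
  have e1 : r * (1 + (2 - s) * r') < r' * (1 + (2 - s) * r) := by nlinarith
  have e2 : (r + s) * (1 + (2 - s) * r') ≤ (r' + s) * (1 + (2 - s) * r) := by
    nlinarith [mul_nonneg (sub_nonneg.2 hrr.le) (sq_nonneg (1 - s))]
  have := mul_lt_mul e1 e2 (by positivity) (by positivity)
  nlinarith

lemma ratioA_lt_right {r s s' : ℝ} (hr : 0 < r) (h0 : 0 ≤ s) (hss : s < s') (h1 : s' ≤ 1) :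
    ratioA r s < ratioA r s' := by
  have hk : 0 < 2 - s' := by linarith
  have hs' : 0 ≤ s' := h0.trans hss.le
  unfold ratioA
  apply div_lt_div₀
  · nlinarith
  · gcongr
  · positivity
  · positivity

lemma ratioB_lt_left {r r' s : ℝ} (hr : 0 < r) (hrr : r < r') (hs : s ∈ Icc (0 : ℝ) 1) :
    ratioB r' s < ratioB r s := by
  rw [← ratioA_inv hr hs, ← ratioA_inv (hr.trans hrr) hs]
  exact ratioA_lt_left (inv_pos.2 (hr.trans hrr)) (inv_strictAnti₀ hr hrr) hs

lemma ratioB_lt_right {r s s' : ℝ} (hr : 0 < r) (h0 : 0 ≤ s) (hss : s < s') (h1 : s' ≤ 1) :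
    ratioB r s < ratioB r s' := by
  rw [← ratioA_inv hr ⟨h0, hss.le.trans h1⟩, ← ratioA_inv hr ⟨h0.trans hss.le, h1⟩]
  exact ratioA_lt_right (inv_pos.2 hr) h0 hss h1

lemma continuousOn_ratioA {r : ℝ → ℝ} (hr : ContinuousOn r (Icc 0 1))
    (h0 : ∀ s ∈ Icc (0 : ℝ) 1, 0 < r s) : ContinuousOn (fun s => ratioA (r s) s) (Icc 0 1) := by
  unfold ratioA
  refine ContinuousOn.div (by fun_prop) (by fun_prop) fun s hs => ?_
  have := h0 s hs
  have : 0 < 2 - s := by linarith [hs.2]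
  positivity

lemma continuousOn_ratioB {r : ℝ → ℝ} (hr : ContinuousOn r (Icc 0 1))
    (h0 : ∀ s ∈ Icc (0 : ℝ) 1, 0 < r s) : ContinuousOn (fun s => ratioB (r s) s) (Icc 0 1) := by
  unfold ratioB
  refine ContinuousOn.div (by fun_prop) (by fun_prop) fun s hs => ?_
  have := h0 s hs
  have : 0 < 2 - s := by linarith [hs.2]
  positivity

set_option maxRecDepth 4000 in
/-- A homogeneous form of the polynomial inequality behind `ratio_mul_lt`. -/
lemma homogeneous_ratio_lt {V s e q i : ℝ} (hV : 0 < V) (hs : 0 < s) (he : 0 < e) (hq : 0 ≤ q)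
    (hi : i = s + e + q) :
    s ^ 2 * (V * i ^ 2 + (s + e) ^ 2) *
        ((2 * V * i + s - V * s) * (V * i ^ 2 + 2 * (s + e) * i - (s + e) ^ 2)) ^ 2 <
      (s + e) ^ 2 * (V * i ^ 2 + s ^ 2) *
        ((2 * V * i + (s + e) - V * (s + e)) * (V * i ^ 2 + 2 * s * i - s ^ 2)) ^ 2 := by
  subst hi
  rw [← sub_pos]
  -- In the variables `V`, `s`, `e`, `q` every coefficient of the expanded difference is positive.
  -- Here `e` and `q` are the gaps from `s` to `t` and from `t` to `1`, and `i` stands for `1`,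
  -- which makes the inequality homogeneous.
  ring_nf
  positivity

/-- With `V = r s = tan²(B/2)` fixed, `ratioA / ratioB` is strictly decreasing in `s`. This is the
inequality that forces the angles at `A` and `B` to grow along a family. -/
lemma ratio_mul_lt {V s t : ℝ} (hV : 0 < V) (hs : 0 < s) (hst : s < t) (ht : t ≤ 1) :
    ratioA (V / t) t * ratioB (V / s) s < ratioA (V / s) s * ratioB (V / t) t := by
  have ht0 : 0 < t := hs.trans hst
  have key : ∀ x : ℝ, 0 < x → x ≤ 1 → ratioA (V / x) x =
        4 * V * (V + x ^ 2) / (2 * V + x - V * x) ^ 2 ∧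
      ratioB (V / x) x = 4 * (1 + V) * x ^ 2 / (V + 2 * x - x ^ 2) ^ 2 ∧
      0 < 2 * V + x - V * x ∧ 0 < V + 2 * x - x ^ 2 := by
    intro x hx hx1
    have h1 : 0 < 2 * V + x - V * x := by nlinarith
    have h2 : 0 < V + 2 * x - x ^ 2 := by nlinarith
    refine ⟨?_, ?_, h1, h2⟩
    · rw [ratioA, show 1 + (2 - x) * (V / x) = (2 * V + x - V * x) / x by field_simp; ring]
      field_simp
    · rw [ratioB, show 2 - x + V / x = (V + 2 * x - x ^ 2) / x by field_simp; ring]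
      field_simp
  obtain ⟨a1, b1, c1, d1⟩ := key s hs (hst.le.trans ht)
  obtain ⟨a2, b2, c2, d2⟩ := key t ht0 ht
  rw [a1, b1, a2, b2, div_mul_div_comm, div_mul_div_comm,
    div_lt_div_iff₀ (by positivity) (by positivity)]
  have := homogeneous_ratio_lt (i := 1) hV hs (sub_pos.2 hst) (sub_nonneg.2 ht) (by ring)
  rw [add_sub_cancel] at this
  have h16 : 0 < 16 * V * (1 + V) := by positivity
  have := mul_lt_mul_of_pos_left this h16
  convert this using 1 <;> ring

/-! ### The family of shapes with bisectors in a given ratio -/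

/-- `r` selects for every `s` the shape of the triangle in which the bisectors from `A` and `B`
are in the ratio `la : lb`. -/
structure IsFamily (la lb : ℝ) (r : ℝ → ℝ) : Prop where
  la_pos : 0 < la
  lb_pos : 0 < lb
  pos : ∀ s ∈ Icc (0 : ℝ) 1, 0 < r s
  eq : ∀ s ∈ Icc (0 : ℝ) 1, lb ^ 2 * ratioA (r s) s = la ^ 2 * ratioB (r s) s

/-- The difference whose zero is the value of a family at `s`. -/
noncomputable def ratioDiff (la lb r s : ℝ) : ℝ := lb ^ 2 * ratioA r s - la ^ 2 * ratioB r s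

lemma ratioDiff_lt {la lb r r' s : ℝ} (ha : 0 < la) (hb : 0 < lb) (hr : 0 < r) (hrr : r < r')
    (hs : s ∈ Icc (0 : ℝ) 1) : ratioDiff la lb r s < ratioDiff la lb r' s := by
  have h1 := mul_lt_mul_of_pos_left (ratioA_lt_left hr hrr hs) (pow_pos hb 2)
  have h2 := mul_lt_mul_of_pos_left (ratioB_lt_left hr hrr hs) (pow_pos ha 2)
  unfold ratioDiff
  linarith

lemma exists_ratioDiff_neg {la lb s : ℝ} (ha : 0 < la) (hb : 0 < lb) (hs : s ∈ Icc (0 : ℝ) 1) :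
    ∃ r, 0 < r ∧ r ≤ 1 ∧ ratioDiff la lb r s < 0 := by
  obtain ⟨h0, h1⟩ := hs
  -- The bounds `ratioA ≤ 8 r` and `ratioB ≥ 4 / 9` below require `r < la² / (18 lb²)`, so `19`
  -- suffices. The bound `r ≤ 1` lets the negative point be placed to the left of the inverse of the
  -- one obtained with `la`, `lb` exchanged.
  set r := min 1 (la ^ 2 / (19 * lb ^ 2)) with hrdef
  have hr : 0 < r := lt_min one_pos (by positivity)
  have hr1 : r ≤ 1 := min_le_left _ _
  have hr2 : r * (19 * lb ^ 2) ≤ la ^ 2 := by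
    rw [← le_div_iff₀ (by positivity)]
    exact min_le_right _ _
  refine ⟨r, hr, hr1, ?_⟩
  have hk : 0 < 2 - s := by linarith
  have hA : ratioA r s ≤ 8 * r := by
    unfold ratioA
    rw [div_le_iff₀ (by positivity)]
    have : (1 : ℝ) ≤ (1 + (2 - s) * r) ^ 2 := one_le_pow₀ (by nlinarith)
    nlinarith
  have hB : 4 / 9 ≤ ratioB r s := by
    unfold ratioB
    rw [div_le_div_iff₀ (by norm_num) (by positivity)]
    have : (2 - s + r) ^ 2 ≤ 3 ^ 2 := pow_le_pow_left₀ (by positivity) (by linarith) 2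
    nlinarith [mul_nonneg hr.le h0]
  have h3 := mul_le_mul_of_nonneg_left hA (sq_nonneg lb)
  have h4 := mul_le_mul_of_nonneg_left hB (sq_nonneg la)
  unfold ratioDiff
  nlinarith [pow_pos ha 2, pow_pos hb 2]

lemma ratioDiff_inv {la lb r s : ℝ} (hr : 0 < r) (hs : s ∈ Icc (0 : ℝ) 1) :
    ratioDiff la lb r⁻¹ s = -ratioDiff lb la r s := by
  rw [ratioDiff, ratioDiff, ratioA_inv hr hs, ratioB_inv hr hs]
  ring

lemma exists_ratioDiff_eq_zero {la lb s : ℝ} (ha : 0 < la) (hb : 0 < lb)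
    (hs : s ∈ Icc (0 : ℝ) 1) : ∃ r, 0 < r ∧ ratioDiff la lb r s = 0 := by
  obtain ⟨x, hx, hx1, hxn⟩ := exists_ratioDiff_neg ha hb hs
  obtain ⟨y, hy, hy1, hyn⟩ := exists_ratioDiff_neg hb ha hs
  have hxy : x ≤ y⁻¹ := hx1.trans ((one_le_inv₀ hy).2 hy1)
  have hcont : ContinuousOn (fun r => ratioDiff la lb r s) (Icc x y⁻¹) := by
    have hk : 0 < 2 - s := by linarith [hs.2]
    unfold ratioDiff ratioA ratioB
    refine ContinuousOn.sub (ContinuousOn.mul (by fun_prop) (ContinuousOn.div (by fun_prop)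
      (by fun_prop) fun r hr => ?_)) (ContinuousOn.mul (by fun_prop) (ContinuousOn.div
      (by fun_prop) (by fun_prop) fun r hr => ?_))
    all_goals
      have := hx.trans_le hr.1
      positivity
  obtain ⟨r, hr, h⟩ := intermediate_value_Icc hxy hcont
    (show (0 : ℝ) ∈ Icc _ _ from ⟨hxn.le, by rw [ratioDiff_inv hy hs]; linarith⟩)
  exact ⟨r, hx.trans_le hr.1, h⟩

lemma exists_isFamily {la lb : ℝ} (ha : 0 < la) (hb : 0 < lb) : ∃ r, IsFamily la lb r := by
  classical
  choose! r hr hr' using fun s (hs : s ∈ Icc (0 : ℝ) 1) =>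
    exists_ratioDiff_eq_zero ha hb hs
  exact ⟨r, ha, hb, hr, fun s hs => sub_eq_zero.1 (hr' s hs)⟩

namespace IsFamily

variable {la lb : ℝ} {r : ℝ → ℝ}

lemma swap (h : IsFamily la lb r) : IsFamily lb la (fun s => (r s)⁻¹) where
  la_pos := h.lb_pos
  lb_pos := h.la_pos
  pos s hs := inv_pos.2 (h.pos s hs)
  eq s hs := by rw [ratioA_inv (h.pos s hs) hs, ratioB_inv (h.pos s hs) hs, h.eq s hs]

lemma eq_of_eq (h : IsFamily la lb r) {s x : ℝ} (hs : s ∈ Icc (0 : ℝ) 1) (hx : 0 < x)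
    (hxs : lb ^ 2 * ratioA x s = la ^ 2 * ratioB x s) : x = r s := by
  have h1 : ratioDiff la lb x s = 0 := sub_eq_zero.2 hxs
  have h2 : ratioDiff la lb (r s) s = 0 := sub_eq_zero.2 (h.eq s hs)
  rcases lt_trichotomy x (r s) with hlt | heq | hlt
  · have := ratioDiff_lt h.la_pos h.lb_pos hx hlt hs
    linarith
  · exact heq
  · have := ratioDiff_lt h.la_pos h.lb_pos (h.pos s hs) hlt hs
    linarith

/-- An implicit function argument by monotonicity: the sign of `ratioDiff` at a fixed level `x`
tells on which side of `x` the value `r s` lies, and this sign persists for nearby `s`. -/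
lemma continuousOn (h : IsFamily la lb r) : ContinuousOn r (Icc 0 1) := by
  intro s₀ hs₀
  have h0 := h.pos s₀ hs₀
  have hz : ∀ s ∈ Icc (0 : ℝ) 1, ratioDiff la lb (r s) s = 0 :=
    fun s hs => sub_eq_zero.2 (h.eq s hs)
  have hc : ∀ x : ℝ, 0 < x → ContinuousWithinAt (fun s => ratioDiff la lb x s) (Icc 0 1) s₀ := by
    intro x hx
    unfold ratioDiff
    exact ((continuousOn_const.mul (continuousOn_ratioA (r := fun _ => x) continuousOn_const
      fun _ _ => hx)).sub (continuousOn_const.mul (continuousOn_ratioB (r := fun _ => x)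
      continuousOn_const fun _ _ => hx))) s₀ hs₀
  refine tendsto_order.2 ⟨fun x hx => ?_, fun x hx => ?_⟩
  -- The level `x` may be nonpositive; the maximum keeps the comparison within positive arguments.
  · have hx' : max x (r s₀ / 2) < r s₀ := max_lt hx (by linarith)
    have hp : 0 < max x (r s₀ / 2) := lt_max_of_lt_right (by linarith)
    have hn : ratioDiff la lb (max x (r s₀ / 2)) s₀ < 0 :=
      (ratioDiff_lt h.la_pos h.lb_pos hp hx' hs₀).trans_eq (hz s₀ hs₀)
    filter_upwards [(hc _ hp).eventually (gt_mem_nhds hn), self_mem_nhdsWithin] with s hs hsI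
    refine (le_max_left x (r s₀ / 2)).trans_lt (lt_of_not_ge fun hle => ?_)
    rcases hle.eq_or_lt with heq | hlt
    · rw [← heq, hz s hsI] at hs
      exact lt_irrefl _ hs
    · have := ratioDiff_lt h.la_pos h.lb_pos (h.pos s hsI) hlt hsI
      rw [hz s hsI] at this
      exact lt_asymm hs this
  · have hp : 0 < x := h0.trans hx
    have hn : 0 < ratioDiff la lb x s₀ :=
      (hz s₀ hs₀).symm.trans_lt (ratioDiff_lt h.la_pos h.lb_pos h0 hx hs₀)
    filter_upwards [(hc _ hp).eventually (lt_mem_nhds hn), self_mem_nhdsWithin] with s hs hsI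
    refine lt_of_not_ge fun hle => ?_
    rcases hle.eq_or_lt with heq | hlt
    · rw [heq, hz s hsI] at hs
      exact lt_irrefl _ hs
    · have := ratioDiff_lt h.la_pos h.lb_pos hp hlt hsI
      rw [hz s hsI] at this
      exact lt_asymm hs this

/-- If `s * r s` did not grow from `s` to `t`, then `r t ≤ s * r s / t`. By `ratio_mul_lt` and
monotonicity in `r`, the quotient `ratioA / ratioB` would be strictly smaller at `t`, whereas it is
constant along the family. -/
lemma strictMonoOn_mul (h : IsFamily la lb r) :
    StrictMonoOn (fun s => s * r s) (Icc 0 1) := by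
  intro s hs t ht hst
  have hr := h.pos s hs
  have hr' := h.pos t ht
  have ht0 : 0 < t := hs.1.trans_lt hst
  rcases hs.1.eq_or_lt with h0 | h0
  · simp only [← h0, zero_mul]
    positivity
  refine lt_of_not_ge fun hle => ?_
  have hV : 0 < s * r s := by positivity
  have h1 := ratio_mul_lt hV h0 hst ht.2
  rw [show s * r s / s = r s by field_simp] at h1
  have hle' : r t ≤ s * r s / t := by rw [le_div_iff₀ ht0]; linarith
  have hA : ratioA (r t) t ≤ ratioA (s * r s / t) t := by
    rcases hle'.eq_or_lt with heq | hlt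
    · rw [← heq]
    · exact (ratioA_lt_left hr' hlt ht).le
  have hB : ratioB (s * r s / t) t ≤ ratioB (r t) t := by
    rcases hle'.eq_or_lt with heq | hlt
    · rw [← heq]
    · exact (ratioB_lt_left hr' hlt ht).le
  have h2 : ratioA (r t) t * ratioB (r s) s < ratioA (r s) s * ratioB (r t) t :=
    calc _ ≤ ratioA (s * r s / t) t * ratioB (r s) s :=
          mul_le_mul_of_nonneg_right hA (ratioB_pos hr hs).le
      _ < ratioA (r s) s * ratioB (s * r s / t) t := h1
      _ ≤ _ := mul_le_mul_of_nonneg_left hB (ratioA_pos hr hs).le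
  have e1 := h.eq s hs
  have e2 := h.eq t ht
  have hb := pow_pos h.lb_pos 2
  have : lb ^ 2 * (ratioA (r t) t * ratioB (r s) s) =
      lb ^ 2 * (ratioA (r s) s * ratioB (r t) t) := by
    linear_combination ratioB (r s) s * e2 - ratioB (r t) t * e1
  exact absurd (mul_left_cancel₀ hb.ne' this) h2.ne

end IsFamily

/-! ### The sides along the family -/

/-- The side `AB` of the member of a family with parameter `s`. -/
noncomputable def sideC (la : ℝ) (r : ℝ → ℝ) (s : ℝ) : ℝ := la / √(ratioA (r s) s)

/-- The side `BC` of the member of a family with parameter `s`. -/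
noncomputable def sideA (la : ℝ) (r : ℝ → ℝ) (s : ℝ) : ℝ :=
  sideC la r s * (1 + r s * s) / ((1 + r s) * (1 - s))

/-- The side `CA` of the member of a family with parameter `s`. -/
noncomputable def sideB (la : ℝ) (r : ℝ → ℝ) (s : ℝ) : ℝ :=
  sideC la r s * (r s + s) / ((1 + r s) * (1 - s))

namespace IsFamily

variable {la lb : ℝ} {r : ℝ → ℝ}

lemma sideC_pos (h : IsFamily la lb r) {s : ℝ} (hs : s ∈ Icc (0 : ℝ) 1) : 0 < sideC la r s :=
  div_pos h.la_pos (Real.sqrt_pos.2 (ratioA_pos (h.pos s hs) hs))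

lemma sideC_sq_mul_ratioA (h : IsFamily la lb r) {s : ℝ} (hs : s ∈ Icc (0 : ℝ) 1) :
    sideC la r s ^ 2 * ratioA (r s) s = la ^ 2 := by
  have := ratioA_pos (h.pos s hs) hs
  rw [sideC, div_pow, Real.sq_sqrt this.le]
  field_simp

lemma sideC_sq_mul_ratioB (h : IsFamily la lb r) {s : ℝ} (hs : s ∈ Icc (0 : ℝ) 1) :
    sideC la r s ^ 2 * ratioB (r s) s = lb ^ 2 := by
  have h1 := h.sideC_sq_mul_ratioA hs
  have h2 := h.eq s hs
  have : la ^ 2 * (sideC la r s ^ 2 * ratioB (r s) s) = la ^ 2 * lb ^ 2 := by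
    linear_combination lb ^ 2 * h1 - sideC la r s ^ 2 * h2
  exact mul_left_cancel₀ (pow_pos h.la_pos 2).ne' this

lemma sideC_swap (h : IsFamily la lb r) {s : ℝ} (hs : s ∈ Icc (0 : ℝ) 1) :
    sideC lb (fun s => (r s)⁻¹) s = sideC la r s := by
  have h1 := h.swap.sideC_sq_mul_ratioA hs
  rw [ratioA_inv (h.pos s hs) hs, ← h.sideC_sq_mul_ratioB hs] at h1
  exact (pow_left_inj₀ (h.swap.sideC_pos hs).le (h.sideC_pos hs).le two_ne_zero).1
    (mul_right_cancel₀ (ratioB_pos (h.pos s hs) hs).ne' h1)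

lemma sideA_swap (h : IsFamily la lb r) {s : ℝ} (hs : s ∈ Icc (0 : ℝ) 1) :
    sideA lb (fun s => (r s)⁻¹) s = sideB la r s := by
  have := h.pos s hs
  rw [sideA, h.sideC_swap hs, sideB]
  -- At `s = 1` both sides are divisions by zero, hence `0`.
  rcases hs.2.eq_or_lt with h1 | h1
  · simp [h1]
  have : 0 < 1 - s := by linarith
  field_simp
  ring

lemma sideB_swap (h : IsFamily la lb r) {s : ℝ} (hs : s ∈ Icc (0 : ℝ) 1) :
    sideB lb (fun s => (r s)⁻¹) s = sideA la r s := by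
  rw [← h.swap.sideA_swap hs]
  simp

/-- Both ratios increase in `s` for fixed `r`. If `r` does not drop from `s` to `t`, then `ratioA`
grows; if it drops, `ratioB` grows. Since `c² * ratioA = la²` and `c² * ratioB = lb²`, the side `c`
shrinks in either case. -/
lemma strictAntiOn_sideC (h : IsFamily la lb r) : StrictAntiOn (sideC la r) (Icc 0 1) := by
  intro s hs t ht hst
  refine lt_of_not_ge fun hle => ?_
  have hcs := h.sideC_pos hs
  have hsq : sideC la r s ^ 2 ≤ sideC la r t ^ 2 := pow_le_pow_left₀ hcs.le hle 2
  have hrs := h.pos s hs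
  have hrt := h.pos t ht
  rcases le_or_gt (r s) (r t) with hr | hr
  · have h1 : ratioA (r s) s < ratioA (r t) t := by
      refine (ratioA_lt_right hrs hs.1 hst ht.2).trans_le ?_
      rcases hr.eq_or_lt with heq | hlt
      · rw [heq]
      · exact (ratioA_lt_left hrs hlt ht).le
    have := mul_lt_mul' hsq h1 (ratioA_pos hrs hs).le (pow_pos (h.sideC_pos ht) 2)
    rw [h.sideC_sq_mul_ratioA hs, h.sideC_sq_mul_ratioA ht] at this
    exact lt_irrefl _ this
  · have h1 : ratioB (r s) s < ratioB (r t) t :=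
      (ratioB_lt_right hrs hs.1 hst ht.2).trans (ratioB_lt_left hrt hr ht)
    have := mul_lt_mul' hsq h1 (ratioB_pos hrs hs).le (pow_pos (h.sideC_pos ht) 2)
    rw [h.sideC_sq_mul_ratioB hs, h.sideC_sq_mul_ratioB ht] at this
    exact lt_irrefl _ this

lemma sideA_pos (h : IsFamily la lb r) {s : ℝ} (hs : s ∈ Ico (0 : ℝ) 1) : 0 < sideA la r s := by
  have := h.pos s (Ico_subset_Icc_self hs)
  have := h.sideC_pos (Ico_subset_Icc_self hs)
  have := hs.1
  have : 0 < 1 - s := sub_pos.2 hs.2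
  unfold sideA
  positivity

lemma sideB_pos (h : IsFamily la lb r) {s : ℝ} (hs : s ∈ Ico (0 : ℝ) 1) : 0 < sideB la r s := by
  rw [← h.sideA_swap (Ico_subset_Icc_self hs)]
  exact h.swap.sideA_pos hs

/-- The classical `lb = 2 a c cos(B/2) / (a + c)`, squared, with `1 + s * r s = 1 / cos²(B/2)`. It
shows that `a` increases: as `B` grows, `1/a + 1/c` decreases, while `1/c` increases. -/
lemma inv_sideA_add_inv_sideC (h : IsFamily la lb r) {s : ℝ} (hs : s ∈ Ico (0 : ℝ) 1) :
    ((sideA la r s)⁻¹ + (sideC la r s)⁻¹) ^ 2 * (lb ^ 2 * (1 + s * r s)) = 4 := by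
  have hs' := Ico_subset_Icc_self hs
  have h1 := h.pos s hs'
  have h2 := h.sideC_pos hs'
  have h3 := hs.1
  have h4 : 0 < 1 - s := sub_pos.2 hs.2
  have h5 : 0 < 2 - s + r s := by linarith
  rw [← h.sideC_sq_mul_ratioB hs', sideA, ratioB]
  field_simp
  ring

lemma strictMonoOn_sideA (h : IsFamily la lb r) : StrictMonoOn (sideA la r) (Ico 0 1) := by
  intro s hs t ht hst
  have hs' := Ico_subset_Icc_self hs
  have ht' := Ico_subset_Icc_self ht
  have e1 := h.inv_sideA_add_inv_sideC hs
  have e2 := h.inv_sideA_add_inv_sideC ht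
  have hc := inv_strictAnti₀ (h.sideC_pos ht') (h.strictAntiOn_sideC hs' ht' hst)
  have hv : s * r s < t * r t := h.strictMonoOn_mul hs' ht' hst
  have p1 := inv_pos.2 (h.sideA_pos hs)
  have p2 := inv_pos.2 (h.sideA_pos ht)
  have p3 := inv_pos.2 (h.sideC_pos hs')
  have hb := pow_pos h.lb_pos 2
  have hv0 : 0 ≤ s * r s := mul_nonneg hs.1 (h.pos s hs').le
  refine (inv_lt_inv₀ (h.sideA_pos ht) (h.sideA_pos hs)).1 (lt_of_not_ge fun hle => ?_)
  have hlt : ((sideA la r s)⁻¹ + (sideC la r s)⁻¹) ^ 2 <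
      ((sideA la r t)⁻¹ + (sideC la r t)⁻¹) ^ 2 :=
    pow_lt_pow_left₀ (by linarith) (by positivity) two_ne_zero
  have hlt2 : lb ^ 2 * (1 + s * r s) < lb ^ 2 * (1 + t * r t) :=
    mul_lt_mul_of_pos_left (by linarith) hb
  have := mul_lt_mul'' hlt hlt2 (by positivity) (by positivity)
  linarith

lemma strictMonoOn_sideB (h : IsFamily la lb r) : StrictMonoOn (sideB la r) (Ico 0 1) :=
  h.swap.strictMonoOn_sideA.congr fun _ hs => h.sideA_swap (Ico_subset_Icc_self hs)

lemma continuousOn_sideC (h : IsFamily la lb r) : ContinuousOn (sideC la r) (Icc 0 1) := by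
  unfold sideC
  exact continuousOn_const.div (continuousOn_ratioA h.continuousOn h.pos).sqrt
    fun s hs => (Real.sqrt_pos.2 (ratioA_pos (h.pos s hs) hs)).ne'

lemma continuousOn_sideA (h : IsFamily la lb r) : ContinuousOn (sideA la r) (Ico 0 1) := by
  have h1 := h.continuousOn.mono (Ico_subset_Icc_self : Ico (0 : ℝ) 1 ⊆ _)
  have h2 := h.continuousOn_sideC.mono (Ico_subset_Icc_self : Ico (0 : ℝ) 1 ⊆ _)
  unfold sideA
  refine ContinuousOn.div (by fun_prop) (by fun_prop) fun s hs => ?_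
  have := h.pos s (Ico_subset_Icc_self hs)
  have : 0 < 1 - s := sub_pos.2 hs.2
  positivity

lemma continuousOn_sideB (h : IsFamily la lb r) : ContinuousOn (sideB la r) (Ico 0 1) :=
  h.swap.continuousOn_sideA.congr fun _ hs => (h.sideA_swap (Ico_subset_Icc_self hs)).symm

lemma tendsto_sideA (h : IsFamily la lb r) : Tendsto (sideA la r) (𝓝[<] 1) atTop := by
  have h1 : (1 : ℝ) ∈ Icc (0 : ℝ) 1 := by norm_num
  have hle : 𝓝[<] (1 : ℝ) ≤ 𝓝[Icc 0 1] 1 := by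
    rw [← nhdsWithin_Ioo_eq_nhdsLT (zero_lt_one' ℝ)]
    exact nhdsWithin_mono _ Ioo_subset_Icc_self
  have hr := (h.continuousOn 1 h1).mono_left hle
  have hc := (h.continuousOn_sideC 1 h1).mono_left hle
  have hs : Tendsto (fun s : ℝ => s) (𝓝[<] 1) (𝓝 1) := tendsto_nhdsWithin_of_tendsto_nhds tendsto_id
  have hnum : Tendsto (fun s => sideC la r s * (1 + r s * s) / (1 + r s)) (𝓝[<] 1)
      (𝓝 (sideC la r 1 * (1 + r 1 * 1) / (1 + r 1))) := by
    have := h.pos 1 h1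
    exact (hc.mul ((hr.mul hs).const_add 1)).div (hr.const_add 1) (by positivity)
  have hinv : Tendsto (fun s : ℝ => (1 - s)⁻¹) (𝓝[<] 1) atTop := by
    refine tendsto_inv_nhdsGT_zero.comp (tendsto_nhdsWithin_iff.2 ⟨?_, ?_⟩)
    · simpa using hs.const_sub 1
    · filter_upwards [self_mem_nhdsWithin] with s hs
      exact sub_pos.2 (mem_Iio.1 hs)
  have hpos : 0 < sideC la r 1 * (1 + r 1 * 1) / (1 + r 1) := by
    have := h.pos 1 h1
    have := h.sideC_pos h1
    positivity
  refine (hnum.pos_mul_atTop hpos hinv).congr fun s => ?_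
  rw [sideA, ← div_eq_mul_inv, div_div]

lemma tendsto_sideB (h : IsFamily la lb r) : Tendsto (sideB la r) (𝓝[<] 1) atTop := by
  refine h.swap.tendsto_sideA.congr' ?_
  filter_upwards [Ioo_mem_nhdsLT (zero_lt_one' ℝ)] with s hs
  exact h.sideA_swap (Ioo_subset_Icc_self hs)

end IsFamily

/-! ### Bisectors, heights and medians in terms of the sides -/

/-- The Euclidean plane. -/
abbrev Plane : Type := EuclideanSpace ℝ (Fin 2)

lemma dist_lt_add_of_not_collinear {A P Q : Plane} (h : ¬ Collinear ℝ {A, P, Q}) :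
    dist P Q < dist A P + dist A Q := by
  refine lt_of_le_of_ne (by simpa only [dist_comm P A] using dist_triangle P A Q) fun heq => h ?_
  rw [dist_comm A P] at heq
  have := (dist_add_dist_eq_iff.1 heq.symm).collinear
  rwa [Set.insert_comm] at this

lemma inner_sub_sub_eq (A P Q : Plane) :
    2 * inner ℝ (P - A) (Q - A) = dist A P ^ 2 + dist A Q ^ 2 - dist P Q ^ 2 := by
  have h : P - Q = (P - A) - (Q - A) := by abel
  rw [dist_comm A P, dist_comm A Q, dist_eq_norm P A, dist_eq_norm Q A, dist_eq_norm P Q, h,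
    norm_sub_sq_real (P - A) (Q - A)]
  ring

lemma abs_inner_lt_of_not_collinear {A P Q : Plane} (h : ¬ Collinear ℝ {A, P, Q}) :
    |inner ℝ (P - A) (Q - A)| < dist A P * dist A Q := by
  have h1 := dist_lt_add_of_not_collinear h
  have h2 : dist A Q < dist P A + dist P Q :=
    dist_lt_add_of_not_collinear (by rwa [Set.insert_comm])
  have h3 : dist P A < dist Q P + dist Q A :=
    dist_lt_add_of_not_collinear (by
      rwa [Set.insert_comm, Set.pair_comm, Set.insert_comm])
  rw [dist_comm P A] at h2 h3
  rw [dist_comm Q P, dist_comm Q A] at h3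
  have h4 := inner_sub_sub_eq A P Q
  have := dist_nonneg (x := P) (y := Q)
  rw [abs_lt]
  constructor <;> nlinarith

/-- For a point dividing `PQ` in the ratio `t : 1 - t`, equality of the two angles amounts to `(1 -
t) AP = t AQ`, the angle bisector theorem. This fixes `t`, and expanding the squared distance from
`A` gives the length. -/
lemma exists_bisector_iff {A P Q : Plane} (h : ¬ Collinear ℝ {A, P, Q}) (l : ℝ) :
    (∃ D, (Sbtw ℝ P D Q ∧ EuclideanGeometry.angle P A D = EuclideanGeometry.angle D A Q) ∧
        dist A D = l) ↔
      0 < l ∧ l ^ 2 * (dist A P + dist A Q) ^ 2 =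
        dist A P * dist A Q * ((dist A P + dist A Q) ^ 2 - dist P Q ^ 2) := by
  have hg := abs_lt.1 (abs_inner_lt_of_not_collinear h)
  have hx := inner_sub_sub_eq A P Q
  have hAP : A ≠ P := fun e => h (by rw [e]; simpa using collinear_pair ℝ P Q)
  have hAQ : A ≠ Q := fun e => h (by
    rw [e, Set.insert_comm, Set.pair_eq_singleton]; exact collinear_pair ℝ P Q)
  have hPQ : P ≠ Q := fun e => h (by rw [e, Set.pair_eq_singleton]; exact collinear_pair ℝ A Q)
  have hz : 0 < dist A P := dist_pos.2 hAP
  have hy : 0 < dist A Q := dist_pos.2 hAQ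
  have nP : ‖P - A‖ = dist A P := by rw [dist_comm, dist_eq_norm]
  have nQ : ‖Q - A‖ = dist A Q := by rw [dist_comm, dist_eq_norm]
  set z := dist A P
  set y := dist A Q
  set g : ℝ := inner ℝ (P - A) (Q - A) with hgdef
  -- the point dividing `P Q` in the ratio `t : 1 - t`
  have point : ∀ t : ℝ, 0 < t → t < 1 →
      0 < dist A (AffineMap.lineMap P Q t) ∧
      dist A (AffineMap.lineMap P Q t) ^ 2 =
        (1 - t) ^ 2 * z ^ 2 + 2 * t * (1 - t) * g + t ^ 2 * y ^ 2 ∧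
      (EuclideanGeometry.angle P A (AffineMap.lineMap P Q t) =
        EuclideanGeometry.angle (AffineMap.lineMap P Q t) A Q ↔ (1 - t) * z = t * y) := by
    intro t ht0 ht1
    have hd : AffineMap.lineMap P Q t - A = (1 - t) • (P - A) + t • (Q - A) := by
      rw [AffineMap.lineMap_apply_module]; module
    have hsq : dist A (AffineMap.lineMap P Q t) ^ 2 =
        (1 - t) ^ 2 * z ^ 2 + 2 * t * (1 - t) * g + t ^ 2 * y ^ 2 := by
      rw [dist_comm, dist_eq_norm, hd, norm_add_sq_real, norm_smul, norm_smul, inner_smul_left,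
        inner_smul_right, nP, nQ, mul_pow, mul_pow, Real.norm_eq_abs, Real.norm_eq_abs, sq_abs,
        sq_abs]
      simp only [conj_trivial]
      ring
    have hpos : 0 < dist A (AffineMap.lineMap P Q t) := by
      refine lt_of_le_of_ne dist_nonneg fun h0 => ?_
      rw [← h0] at hsq
      nlinarith [sq_nonneg ((1 - t) * z - t * y), mul_pos ht0 (sub_pos.2 ht1)]
    refine ⟨hpos, hsq, ?_⟩
    have i1 : inner ℝ (P - A) (AffineMap.lineMap P Q t - A) = (1 - t) * z ^ 2 + t * g := by
      rw [hd, inner_add_right, inner_smul_right, inner_smul_right, real_inner_self_eq_norm_sq, nP]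
    have i2 : inner ℝ (AffineMap.lineMap P Q t - A) (Q - A) = (1 - t) * g + t * y ^ 2 := by
      rw [hd, inner_add_left, inner_smul_left, inner_smul_left, real_inner_self_eq_norm_sq, nQ]
      simp [hgdef]
    have nD : ‖AffineMap.lineMap P Q t - A‖ = dist A (AffineMap.lineMap P Q t) := by
      rw [dist_comm, dist_eq_norm]
    unfold EuclideanGeometry.angle InnerProductGeometry.angle
    rw [vsub_eq_sub, vsub_eq_sub, vsub_eq_sub]
    have hcs1 := abs_le.1 (abs_real_inner_div_norm_mul_norm_le_one (P - A)
      (AffineMap.lineMap P Q t - A))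
    have hcs2 := abs_le.1 (abs_real_inner_div_norm_mul_norm_le_one
      (AffineMap.lineMap P Q t - A) (Q - A))
    rw [Real.arccos_inj hcs1.1 hcs1.2 hcs2.1 hcs2.2, i1, i2, nD, nP, nQ,
      div_eq_div_iff (by positivity) (by positivity)]
    -- Equality of the two cosines factors as `(z y - g) ((1 - t) z - t y) = 0`; the first factor is
    -- nonzero by the strict Cauchy–Schwarz inequality.
    have hne : z * y - g ≠ 0 := by linarith [hg.2]
    constructor
    · intro he
      have : (z * y - g) * ((1 - t) * z - t * y) = 0 := by
        refine mul_left_cancel₀ hpos.ne' ?_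
        linear_combination he
      linarith [(mul_eq_zero.1 this).resolve_left hne]
    · intro he
      linear_combination (dist A (AffineMap.lineMap P Q t)) * (z * y - g) * he
  have key : ∀ t : ℝ, (1 - t) * z = t * y →
      ((1 - t) ^ 2 * z ^ 2 + 2 * t * (1 - t) * g + t ^ 2 * y ^ 2) * (z + y) ^ 2 =
        z * y * ((z + y) ^ 2 - dist P Q ^ 2) := by
    intro t ht
    have h5 : t * (y + z) = z := by linarith
    have h6 : (1 - t) * (y + z) = y := by linarith
    calc _ = ((1 - t) * (y + z)) ^ 2 * z ^ 2 + 2 * (t * (y + z)) * ((1 - t) * (y + z)) * g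
          + (t * (y + z)) ^ 2 * y ^ 2 := by ring
      _ = _ := by rw [h5, h6]; linear_combination z * y * hx
  constructor
  · rintro ⟨D, ⟨hs, hang⟩, rfl⟩
    obtain ⟨⟨t, ht, rfl⟩, -⟩ := sbtw_iff_mem_image_Ioo_and_ne.1 hs
    obtain ⟨h1, h2, h3⟩ := point t ht.1 ht.2
    refine ⟨h1, ?_⟩
    rw [h2, key t (h3.1 hang)]
  · rintro ⟨hl, he⟩
    have ht0 : 0 < z / (y + z) := by positivity
    have ht1 : z / (y + z) < 1 := by rw [div_lt_one (by positivity)]; linarith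
    obtain ⟨h1, h2, h3⟩ := point _ ht0 ht1
    have h4 : (1 - z / (y + z)) * z = z / (y + z) * y := by field_simp; ring
    refine ⟨AffineMap.lineMap P Q (z / (y + z)), ⟨?_, h3.2 h4⟩, ?_⟩
    · exact sbtw_iff_mem_image_Ioo_and_ne.2 ⟨⟨_, ⟨ht0, ht1⟩, rfl⟩, hPQ⟩
    · refine (pow_left_inj₀ h1.le hl.le two_ne_zero).1 ?_
      have hp : (z + y) ^ 2 ≠ 0 := by positivity
      refine mul_right_cancel₀ hp ?_
      rw [he, h2, key _ h4]

lemma not_collinear_points (T : PlaneTriangle) (i : Fin 3) :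
    ¬ Collinear ℝ {T.points i, T.points (i + 1), T.points (i + 2)} := by
  intro h
  refine affineIndependent_iff_not_collinear.1 T.independent (h.subset ?_)
  rintro _ ⟨j, rfl⟩
  fin_cases i <;> fin_cases j <;> simp

lemma hasBisectorLength_iff (T : PlaneTriangle) (i : Fin 3) (l : ℝ) :
    HasBisectorLength T i l ↔
      0 < l ∧ l ^ 2 * (dist (T.points i) (T.points (i + 1)) +
          dist (T.points i) (T.points (i + 2))) ^ 2 =
        dist (T.points i) (T.points (i + 1)) * dist (T.points i) (T.points (i + 2)) *
          ((dist (T.points i) (T.points (i + 1)) + dist (T.points i) (T.points (i + 2))) ^ 2 -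
            dist (T.points (i + 1)) (T.points (i + 2)) ^ 2) :=
  exists_bisector_iff (not_collinear_points T i) l

lemma height_sq (T : PlaneTriangle) (i : Fin 3) :
    4 * dist (T.points (i + 1)) (T.points (i + 2)) ^ 2 * T.height i ^ 2 =
      4 * dist (T.points (i + 1)) (T.points (i + 2)) ^ 2 *
          dist (T.points i) (T.points (i + 1)) ^ 2 -
        (dist (T.points (i + 1)) (T.points (i + 2)) ^ 2 +
          dist (T.points i) (T.points (i + 1)) ^ 2 -
          dist (T.points i) (T.points (i + 2)) ^ 2) ^ 2 := by
  have hmem := T.altitudeFoot_mem_affineSpan_image_compl i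
  have hc : ({i}ᶜ : Set (Fin 3)) = {i + 1, i + 2} := by
    ext j; fin_cases i <;> fin_cases j <;> simp
  rw [hc, Set.image_pair] at hmem
  obtain ⟨τ, hτ⟩ := mem_affineSpan_pair_iff_exists_lineMap_eq.1 hmem
  have h1 := T.inner_vsub_vsub_altitudeFoot_eq_height_sq (i := i) (j := i + 1)
    (by fin_cases i <;> simp)
  have h2 := T.inner_vsub_vsub_altitudeFoot_eq_height_sq (i := i) (j := i + 2)
    (by fin_cases i <;> simp)
  have hh : T.height i = ‖T.points i - T.altitudeFoot i‖ := by
    rw [Affine.Simplex.height, dist_eq_norm]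
  set A := T.points i
  set P := T.points (i + 1)
  set Q := T.points (i + 2)
  set H := T.altitudeFoot i
  simp only [vsub_eq_sub] at h1 h2
  have horth : inner ℝ (A - H) (Q - P) = 0 := by
    have : Q - P = (A - P) - (A - Q) := by abel
    rw [this, inner_sub_right, real_inner_comm, h1, real_inner_comm, h2, sub_self]
  have eP : A - P = (A - H) + τ • (Q - P) := by
    rw [← hτ, AffineMap.lineMap_apply_module]; module
  have eQ : A - Q = (A - H) + (τ - 1) • (Q - P) := by
    rw [← hτ, AffineMap.lineMap_apply_module]; module
  have dP : dist A P ^ 2 = T.height i ^ 2 + τ ^ 2 * dist P Q ^ 2 := by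
    rw [dist_eq_norm, eP, norm_add_sq_real, inner_smul_right, horth, hh, norm_smul, mul_pow,
      Real.norm_eq_abs, sq_abs, dist_comm, dist_eq_norm]
    ring
  have dQ : dist A Q ^ 2 = T.height i ^ 2 + (τ - 1) ^ 2 * dist P Q ^ 2 := by
    rw [dist_eq_norm, eQ, norm_add_sq_real, inner_smul_right, horth, hh, norm_smul, mul_pow,
      Real.norm_eq_abs, sq_abs, dist_comm P, dist_eq_norm]
    ring
  rw [dP, dQ]
  ring

lemma medianLength_sq (T : PlaneTriangle) (i : Fin 3) :
    4 * medianLength T i ^ 2 = 2 * dist (T.points i) (T.points (i + 1)) ^ 2 +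
      2 * dist (T.points i) (T.points (i + 2)) ^ 2 -
        dist (T.points (i + 1)) (T.points (i + 2)) ^ 2 := by
  have := EuclideanGeometry.dist_sq_add_dist_sq_eq_two_mul_dist_midpoint_sq_add_half_dist_sq
    (T.points i) (T.points (i + 1)) (T.points (i + 2))
  unfold medianLength
  linarith

/-- The triangle `T` has the sides `a`, `b`, `c` opposite to `A`, `B`, `C`. -/
structure HasSides (T : PlaneTriangle) (a b c : ℝ) : Prop where
  a_eq : dist (T.points 1) (T.points 2) = a
  b_eq : dist (T.points 2) (T.points 0) = b
  c_eq : dist (T.points 0) (T.points 1) = c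

/-- The relation between the sides of a triangle and the bisector `l` opposite to the side `a`. -/
def BisectorRel (l a b c : ℝ) : Prop := l ^ 2 * (b + c) ^ 2 = b * c * ((b + c) ^ 2 - a ^ 2)

lemma BisectorRel.comm {l a b c : ℝ} : BisectorRel l a b c ↔ BisectorRel l a c b := by
  unfold BisectorRel
  rw [add_comm b c, mul_comm b c]

lemma BisectorRel.unique {l l' a b c : ℝ} (hb : 0 < b) (hc : 0 < c) (hl : 0 < l) (hl' : 0 < l')
    (h : BisectorRel l a b c) (h' : BisectorRel l' a b c) : l = l' := by
  refine (pow_left_inj₀ hl.le hl'.le two_ne_zero).1 (mul_right_cancel₀ ?_ (Eq.trans h h'.symm))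
  positivity

namespace HasSides

variable {T T' : PlaneTriangle} {a b c : ℝ}

lemma congruent (h : HasSides T a b c) (h' : HasSides T' a b c) :
    Congruent T.points T'.points := by
  rw [congruent_iff_dist_eq]
  intro i j
  have e1 := h.a_eq.trans h'.a_eq.symm
  have e2 := h.b_eq.trans h'.b_eq.symm
  have e3 := h.c_eq.trans h'.c_eq.symm
  fin_cases i <;> fin_cases j <;> simp [e1, e2, e3] <;>
    rw [dist_comm, dist_comm (T'.points _)] <;> assumption

lemma bisector_zero_iff (h : HasSides T a b c) {l : ℝ} (hl : 0 < l) :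
    HasBisectorLength T 0 l ↔ BisectorRel l a b c := by
  rw [hasBisectorLength_iff]
  have e1 : dist (T.points 0) (T.points (0 + 1)) = c := h.c_eq
  have e2 : dist (T.points 0) (T.points (0 + 2)) = b := by rw [dist_comm]; exact h.b_eq
  have e3 : dist (T.points (0 + 1)) (T.points (0 + 2)) = a := h.a_eq
  rw [e1, e2, e3, BisectorRel.comm]
  exact and_iff_right hl

lemma bisector_one_iff (h : HasSides T a b c) {l : ℝ} (hl : 0 < l) :
    HasBisectorLength T 1 l ↔ BisectorRel l b a c := by
  rw [hasBisectorLength_iff]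
  have e1 : dist (T.points 1) (T.points (1 + 1)) = a := h.a_eq
  have e2 : dist (T.points 1) (T.points (1 + 2)) = c := by rw [dist_comm]; exact h.c_eq
  have e3 : dist (T.points (1 + 1)) (T.points (1 + 2)) = b := h.b_eq
  rw [e1, e2, e3]
  exact and_iff_right hl

lemma height_zero (h : HasSides T a b c) :
    4 * a ^ 2 * T.height 0 ^ 2 = 4 * a ^ 2 * c ^ 2 - (a ^ 2 + c ^ 2 - b ^ 2) ^ 2 := by
  have := height_sq T 0
  have e1 : dist (T.points 0) (T.points (0 + 1)) = c := h.c_eq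
  have e2 : dist (T.points 0) (T.points (0 + 2)) = b := by rw [dist_comm]; exact h.b_eq
  have e3 : dist (T.points (0 + 1)) (T.points (0 + 2)) = a := h.a_eq
  rwa [e1, e2, e3] at this

lemma height_one (h : HasSides T a b c) :
    4 * b ^ 2 * T.height 1 ^ 2 = 4 * b ^ 2 * a ^ 2 - (b ^ 2 + a ^ 2 - c ^ 2) ^ 2 := by
  have := height_sq T 1
  have e1 : dist (T.points 1) (T.points (1 + 1)) = a := h.a_eq
  have e2 : dist (T.points 1) (T.points (1 + 2)) = c := by rw [dist_comm]; exact h.c_eq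
  have e3 : dist (T.points (1 + 1)) (T.points (1 + 2)) = b := h.b_eq
  rwa [e1, e2, e3] at this

lemma height_two (h : HasSides T a b c) :
    4 * c ^ 2 * T.height 2 ^ 2 = 4 * c ^ 2 * b ^ 2 - (c ^ 2 + b ^ 2 - a ^ 2) ^ 2 := by
  have := height_sq T 2
  have e1 : dist (T.points 2) (T.points (2 + 1)) = b := h.b_eq
  have e2 : dist (T.points 2) (T.points (2 + 2)) = a := by rw [dist_comm]; exact h.a_eq
  have e3 : dist (T.points (2 + 1)) (T.points (2 + 2)) = c := h.c_eq
  rwa [e1, e2, e3] at this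

lemma median_zero (h : HasSides T a b c) :
    4 * medianLength T 0 ^ 2 = 2 * b ^ 2 + 2 * c ^ 2 - a ^ 2 := by
  have := medianLength_sq T 0
  have e1 : dist (T.points 0) (T.points (0 + 1)) = c := h.c_eq
  have e2 : dist (T.points 0) (T.points (0 + 2)) = b := by rw [dist_comm]; exact h.b_eq
  have e3 : dist (T.points (0 + 1)) (T.points (0 + 2)) = a := h.a_eq
  rw [e1, e2, e3] at this
  linarith

lemma median_one (h : HasSides T a b c) :
    4 * medianLength T 1 ^ 2 = 2 * a ^ 2 + 2 * c ^ 2 - b ^ 2 := by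
  have := medianLength_sq T 1
  have e1 : dist (T.points 1) (T.points (1 + 1)) = a := h.a_eq
  have e2 : dist (T.points 1) (T.points (1 + 2)) = c := by rw [dist_comm]; exact h.c_eq
  have e3 : dist (T.points (1 + 1)) (T.points (1 + 2)) = b := h.b_eq
  rwa [e1, e2, e3] at this

lemma median_two (h : HasSides T a b c) :
    4 * medianLength T 2 ^ 2 = 2 * a ^ 2 + 2 * b ^ 2 - c ^ 2 := by
  have := medianLength_sq T 2
  have e1 : dist (T.points 2) (T.points (2 + 1)) = b := h.b_eq
  have e2 : dist (T.points 2) (T.points (2 + 2)) = a := by rw [dist_comm]; exact h.a_eq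
  have e3 : dist (T.points (2 + 1)) (T.points (2 + 2)) = c := h.c_eq
  rw [e1, e2, e3] at this
  linarith

lemma triangle_ineq (h : HasSides T a b c) : a < b + c ∧ b < a + c ∧ c < a + b := by
  have h0 := dist_lt_add_of_not_collinear (not_collinear_points T 0)
  have h1 := dist_lt_add_of_not_collinear (not_collinear_points T 1)
  have h2 := dist_lt_add_of_not_collinear (not_collinear_points T 2)
  have e1 := h.a_eq
  have e2 := h.b_eq
  have e3 := h.c_eq
  have e1' := dist_comm (T.points 1) (T.points 2)
  have e2' := dist_comm (T.points 2) (T.points 0)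
  have e3' := dist_comm (T.points 0) (T.points 1)
  have i1 : (1 : Fin 3) + 2 = 0 := rfl
  have i2 : (2 : Fin 3) + 2 = 1 := rfl
  have i3 : (2 : Fin 3) + 1 = 0 := rfl
  have i4 : (1 : Fin 3) + 1 = 2 := rfl
  simp only [zero_add, i1, i2, i3, i4] at h0 h1 h2
  refine ⟨?_, ?_, ?_⟩ <;> linarith

end HasSides

lemma exists_hasSides (T : PlaneTriangle) : ∃ a b c, HasSides T a b c :=
  ⟨_, _, _, rfl, rfl, rfl⟩

lemma exists_triangle {a b c : ℝ} (ha : a < b + c) (hb : b < a + c) (hc : c < a + b) :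
    ∃ T : PlaneTriangle, HasSides T a b c := by
  have a0 : 0 < a := by linarith
  have b0 : 0 < b := by linarith
  have c0 : 0 < c := by linarith
  set p := (b ^ 2 + c ^ 2 - a ^ 2) / (2 * c) with hp
  have hpc : 2 * c * p = b ^ 2 + c ^ 2 - a ^ 2 := by rw [hp]; field_simp
  have hq : 0 ≤ b ^ 2 - p ^ 2 := by
    have h1 : 2 * c * p ≤ 2 * c * b := by rw [hpc]; nlinarith
    have h2 : 2 * c * (-b) ≤ 2 * c * p := by rw [hpc]; nlinarith
    have h3 : p ≤ b := le_of_mul_le_mul_left h1 (by positivity)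
    have h4 : -b ≤ p := le_of_mul_le_mul_left h2 (by positivity)
    nlinarith
  set A : Plane := !₂[0, 0]
  set B : Plane := !₂[c, 0]
  set C : Plane := !₂[p, √(b ^ 2 - p ^ 2)]
  have dAB : dist A B = c := by
    simp [A, B, EuclideanSpace.dist_eq, Real.dist_eq, Real.sqrt_sq c0.le]
  have dCA : dist C A = b := by
    simp [A, C, EuclideanSpace.dist_eq, Real.dist_eq, Real.sq_sqrt hq, Real.sqrt_sq b0.le]
  have dBC : dist B C = a := by
    have : (c - p) ^ 2 + (b ^ 2 - p ^ 2) = a ^ 2 := by linear_combination -hpc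
    simp [B, C, EuclideanSpace.dist_eq, Real.dist_eq, Real.sq_sqrt hq, this, Real.sqrt_sq a0.le]
  have hind : AffineIndependent ℝ ![A, B, C] := by
    rw [affineIndependent_iff_not_collinear_set]
    intro hcol
    have e1 := dist_comm A B
    have e2 := dist_comm B C
    have e3 := dist_comm C A
    rcases hcol.wbtw_or_wbtw_or_wbtw with h | h | h
    all_goals
      have := h.dist_add_dist
      linarith
  exact ⟨⟨![A, B, C], hind⟩, dBC, dCA, dAB⟩

/-! ### Correspondence between triangles and parameters -/

namespace IsFamily

variable {la lb : ℝ} {r : ℝ → ℝ}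

lemma bisectorRel_sideA (h : IsFamily la lb r) {s : ℝ} (hs : s ∈ Ico (0 : ℝ) 1) :
    BisectorRel la (sideA la r s) (sideB la r s) (sideC la r s) := by
  have hs' := Ico_subset_Icc_self hs
  have h1 := h.pos s hs'
  have h2 := h.sideC_pos hs'
  have h3 := hs.1
  have h4 : 0 < 1 - s := sub_pos.2 hs.2
  have h5 : 0 < 2 - s := by linarith
  rw [BisectorRel, ← h.sideC_sq_mul_ratioA hs', sideA, sideB, ratioA]
  generalize sideC la r s = c at *
  generalize r s = x at *
  field_simp
  ring

lemma bisectorRel_sideB (h : IsFamily la lb r) {s : ℝ} (hs : s ∈ Ico (0 : ℝ) 1) :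
    BisectorRel lb (sideB la r s) (sideA la r s) (sideC la r s) := by
  have hs' := Ico_subset_Icc_self hs
  simpa only [h.sideA_swap hs', h.sideB_swap hs', h.sideC_swap hs'] using
    h.swap.bisectorRel_sideA hs

lemma sideA_add_sideB_sub (h : IsFamily la lb r) {s : ℝ} (hs : s ∈ Ico (0 : ℝ) 1) :
    sideA la r s + sideB la r s - sideC la r s = 2 * sideC la r s * s / (1 - s) := by
  have h1 := h.pos s (Ico_subset_Icc_self hs)
  have h4 : 0 < 1 - s := sub_pos.2 hs.2
  rw [sideA, sideB]
  field_simp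
  ring

lemma sideA_lt (h : IsFamily la lb r) {s : ℝ} (hs : s ∈ Ico (0 : ℝ) 1) :
    sideA la r s < sideB la r s + sideC la r s := by
  have h1 := h.pos s (Ico_subset_Icc_self hs)
  have h2 := h.sideC_pos (Ico_subset_Icc_self hs)
  have h4 : 0 < 1 - s := sub_pos.2 hs.2
  have : sideB la r s + sideC la r s - sideA la r s = 2 * sideC la r s * r s / (1 + r s) := by
    rw [sideA, sideB]
    field_simp
    ring
  have : 0 < 2 * sideC la r s * r s / (1 + r s) := by positivity
  linarith

lemma sideB_lt (h : IsFamily la lb r) {s : ℝ} (hs : s ∈ Ico (0 : ℝ) 1) :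
    sideB la r s < sideA la r s + sideC la r s := by
  have hs' := Ico_subset_Icc_self hs
  simpa only [h.sideA_swap hs', h.sideB_swap hs', h.sideC_swap hs'] using h.swap.sideA_lt hs

lemma exists_hasSides (h : IsFamily la lb r) {s : ℝ} (hs : s ∈ Ioo (0 : ℝ) 1) :
    ∃ T, HasSides T (sideA la r s) (sideB la r s) (sideC la r s) := by
  have hs' := Ioo_subset_Ico_self hs
  refine exists_triangle (h.sideA_lt hs') (h.sideB_lt hs') ?_
  have h1 := h.sideC_pos (Ioo_subset_Icc_self hs)
  have h2 := h.sideA_add_sideB_sub hs'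
  have h3 := hs.1
  have h4 : 0 < 1 - s := sub_pos.2 hs.2
  have : 0 < 2 * sideC la r s * s / (1 - s) := by positivity
  linarith

/-- The parameter is read off from the sides as `(p - c) / p`; uniqueness of the shape for given `s`
identifies `(p - a) / (p - b)` with `r s`, and then the bisector `la` fixes the scale. -/
lemma exists_parameter (h : IsFamily la lb r) {a b c : ℝ} (ha : a < b + c) (hb : b < a + c)
    (hc : c < a + b) (h0 : BisectorRel la a b c) (h1 : BisectorRel lb b a c) :
    ∃ s ∈ Ioo (0 : ℝ) 1, a = sideA la r s ∧ b = sideB la r s ∧ c = sideC la r s := by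
  have a0 : 0 < a := by linarith
  have b0 : 0 < b := by linarith
  have c0 : 0 < c := by linarith
  have hA : 0 < b + c - a := by linarith
  have hB : 0 < a + c - b := by linarith
  set s := (a + b - c) / (a + b + c) with hs
  set x := (b + c - a) / (a + c - b) with hx
  have hs0 : 0 < s := div_pos (by linarith) (by linarith)
  have hs1 : s < 1 := by rw [hs, div_lt_one (by linarith)]; linarith
  have hsI : s ∈ Icc (0 : ℝ) 1 := ⟨hs0.le, hs1.le⟩
  have hx0 : 0 < x := div_pos (by linarith) (by linarith)
  have e1 : x + s = 4 * b * c / ((a + c - b) * (a + b + c)) := by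
    rw [hx, hs]; field_simp; ring
  have e2 : 1 + (2 - s) * x = 4 * c * (b + c) / ((a + c - b) * (a + b + c)) := by
    rw [hx, hs]; field_simp; ring
  have e3 : 1 + x * s = 4 * a * c / ((a + c - b) * (a + b + c)) := by
    rw [hx, hs]; field_simp; ring
  have e4 : 2 - s + x = 4 * c * (a + c) / ((a + c - b) * (a + b + c)) := by
    rw [hx, hs]; field_simp; ring
  have hrA : c ^ 2 * ratioA x s = la ^ 2 := by
    have hh : la ^ 2 = b * c * ((b + c) ^ 2 - a ^ 2) / (b + c) ^ 2 := by
      rw [eq_div_iff (by positivity)]; exact h0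
    rw [ratioA, e1, e2, hx, hh]
    field_simp
    ring
  have hrB : c ^ 2 * ratioB x s = lb ^ 2 := by
    have hh : lb ^ 2 = a * c * ((a + c) ^ 2 - b ^ 2) / (a + c) ^ 2 := by
      rw [eq_div_iff (by positivity)]; exact h1
    rw [ratioB, e3, e4, hh]
    field_simp
    ring
  have hxr : x = r s := by
    refine h.eq_of_eq hsI hx0 ?_
    rw [← hrA, ← hrB]
    ring
  have hcc : c = sideC la r s := by
    have := h.sideC_sq_mul_ratioA hsI
    rw [← hxr, ← hrA] at this
    exact (pow_left_inj₀ c0.le (h.sideC_pos hsI).le two_ne_zero).1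
      (mul_right_cancel₀ (ratioA_pos hx0 hsI).ne' this.symm)
  have e5 : 1 + x = 2 * c / (a + c - b) := by rw [hx]; field_simp; ring
  have e6 : 1 - s = 2 * c / (a + b + c) := by rw [hs]; field_simp; ring
  refine ⟨s, ⟨hs0, hs1⟩, ?_, ?_, hcc⟩
  · rw [sideA, ← hcc, ← hxr, e3, e5, e6]
    field_simp
    ring
  · rw [sideB, ← hcc, ← hxr, e1, e5, e6]
    field_simp
    ring

lemma exists_parameter_of_triangle (h : IsFamily la lb r) {T : PlaneTriangle}
    (h0 : HasBisectorLength T 0 la) (h1 : HasBisectorLength T 1 lb) :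
    ∃ s ∈ Ioo (0 : ℝ) 1, HasSides T (sideA la r s) (sideB la r s) (sideC la r s) := by
  obtain ⟨a, b, c, hT⟩ := TwoBisectors.exists_hasSides T
  obtain ⟨ha, hb, hc⟩ := hT.triangle_ineq
  obtain ⟨s, hs, ea, eb, ec⟩ := h.exists_parameter ha hb hc ((hT.bisector_zero_iff h.la_pos).1 h0)
    ((hT.bisector_one_iff h.lb_pos).1 h1)
  exact ⟨s, hs, ea ▸ eb ▸ ec ▸ hT⟩

/-- The function `F` of the parameter gives the element `f` of the triangles of a family. -/
def Realizes (la : ℝ) (r : ℝ → ℝ) (f : PlaneTriangle → ℝ) (F : ℝ → ℝ) : Prop :=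
  ∀ s ∈ Ioo (0 : ℝ) 1, ∀ T, HasSides T (sideA la r s) (sideB la r s) (sideC la r s) → f T = F s

variable {f : PlaneTriangle → ℝ} {F : ℝ → ℝ} {x : ℝ}

lemma mem_trianglesWith (h : IsFamily la lb r) (hf : Realizes la r f F) {s : ℝ}
    (hs : s ∈ Ioo (0 : ℝ) 1) (hx : F s = x) {T : PlaneTriangle}
    (hT : HasSides T (sideA la r s) (sideB la r s) (sideC la r s)) :
    T ∈ trianglesWith la lb f x :=
  ⟨(hT.bisector_zero_iff h.la_pos).2 (h.bisectorRel_sideA (Ioo_subset_Ico_self hs)),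
    (hT.bisector_one_iff h.lb_pos).2 (h.bisectorRel_sideB (Ioo_subset_Ico_self hs)),
    (hf s hs T hT).trans hx⟩

lemma exists_of_mem_trianglesWith (h : IsFamily la lb r) (hf : Realizes la r f F)
    {T : PlaneTriangle} (hT : T ∈ trianglesWith la lb f x) :
    ∃ s ∈ Ioo (0 : ℝ) 1, HasSides T (sideA la r s) (sideB la r s) (sideC la r s) ∧ F s = x := by
  obtain ⟨s, hs, hsT⟩ := h.exists_parameter_of_triangle hT.1 hT.2.1
  exact ⟨s, hs, hsT, (hf s hs T hsT).symm.trans hT.2.2⟩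

lemma trianglesWith_eq_empty (h : IsFamily la lb r) (hf : Realizes la r f F)
    (hx : ∀ s ∈ Ioo (0 : ℝ) 1, F s ≠ x) : trianglesWith la lb f x = ∅ := by
  rw [Set.eq_empty_iff_forall_notMem]
  intro T hT
  obtain ⟨s, hs, -, e⟩ := h.exists_of_mem_trianglesWith hf hT
  exact hx s hs e

lemma exactlyOne (h : IsFamily la lb r) (hf : Realizes la r f F)
    (hx : ∃ s ∈ Ioo (0 : ℝ) 1, F s = x ∧ ∀ t ∈ Ioo (0 : ℝ) 1, F t = x → t = s) :
    ExactlyOne (trianglesWith la lb f x) := by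
  obtain ⟨s, hs, hsx, huniq⟩ := hx
  obtain ⟨T₁, hT₁⟩ := h.exists_hasSides hs
  refine ⟨T₁, h.mem_trianglesWith hf hs hsx hT₁, fun T hT => ?_⟩
  obtain ⟨t, ht, htT, e⟩ := h.exists_of_mem_trianglesWith hf hT
  rw [huniq t ht e] at htT
  exact htT.congruent hT₁

lemma sideA_eq_sideB (h : IsFamily la lb r) (hab : la = lb) {s : ℝ} (hs : s ∈ Ico (0 : ℝ) 1) :
    sideA la r s = sideB la r s := by
  have hs' := Ico_subset_Icc_self hs
  have h1 : (1 : ℝ) = r s := by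
    refine h.eq_of_eq hs' one_pos ?_
    rw [← ratioA_inv one_pos hs', inv_one, hab]
  rw [sideA, sideB, ← h1, one_mul]

/-- From `s` to `t` two sides grow and the third shrinks, which excludes every matching of sides
except the two cyclic ones. A cyclic matching carries one prescribed bisector to the other, so `la =
lb`; then both triangles have `a = b`, and the matching contradicts the growth of that side. -/
lemma not_congruent_comp (h : IsFamily la lb r) {s t : ℝ} (hs : s ∈ Ioo (0 : ℝ) 1)
    (ht : t ∈ Ioo (0 : ℝ) 1) (hst : s < t) {T₁ T₂ : PlaneTriangle}
    (h₁ : HasSides T₁ (sideA la r s) (sideB la r s) (sideC la r s))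
    (h₂ : HasSides T₂ (sideA la r t) (sideB la r t) (sideC la r t)) (σ : Equiv.Perm (Fin 3)) :
    ¬ Congruent (T₁.points ∘ σ) T₂.points := by
  intro hc
  rw [congruent_iff_dist_eq] at hc
  have hs' := Ioo_subset_Ico_self hs
  have ht' := Ioo_subset_Ico_self ht
  have la' := h.strictMonoOn_sideA hs' ht' hst
  have lb' := h.strictMonoOn_sideB hs' ht' hst
  have lc' := h.strictAntiOn_sideC (Ioo_subset_Icc_self hs) (Ioo_subset_Icc_self ht) hst
  have d12 := (hc 1 2).trans h₂.a_eq
  have d20 := (hc 2 0).trans h₂.b_eq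
  have d01 := (hc 0 1).trans h₂.c_eq
  simp only [Function.comp_apply] at d12 d20 d01
  have n01 : σ 0 ≠ σ 1 := σ.injective.ne (by decide)
  have n12 : σ 1 ≠ σ 2 := σ.injective.ne (by decide)
  have n20 : σ 2 ≠ σ 0 := σ.injective.ne (by decide)
  have ea := h₁.a_eq
  have eb := h₁.b_eq
  have ec := h₁.c_eq
  have ea' := (dist_comm _ _).trans ea
  have eb' := (dist_comm _ _).trans eb
  have ec' := (dist_comm _ _).trans ec
  have pa := h.sideA_pos hs'
  have pb := h.sideB_pos hs'
  have pc := h.sideC_pos (Ioo_subset_Icc_self hs)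
  have cyc : la = lb → sideA la r t = sideB la r s ∨ sideB la r t = sideA la r s → False := by
    intro e hor
    have e1 := h.sideA_eq_sideB e hs'
    rcases hor with h' | h' <;> linarith
  have Rb := h.bisectorRel_sideB hs'
  have Ra := h.bisectorRel_sideA hs'
  have Rb' := h.bisectorRel_sideB ht'
  have Ra' := h.bisectorRel_sideA ht'
  generalize σ 0 = i at *
  generalize σ 1 = j at *
  generalize σ 2 = k at *
  fin_cases i <;> fin_cases j <;> fin_cases k <;>
    simp only [Fin.zero_eta, Fin.mk_one, Fin.reduceFinMk, ne_eq, not_true_eq_false] at n01 n12 n20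
  all_goals
    simp only [Fin.zero_eta, Fin.mk_one, Fin.reduceFinMk, ea, eb, ec, ea', eb', ec'] at d12 d20 d01
    first
      | (exfalso; linarith)
      | skip
  -- Only the two 3-cycles are left. Here the bisector from `A` of the second triangle is the
  -- bisector from `B` of the first.
  · rw [← d12, ← d20, ← d01] at Ra'
    exact cyc (BisectorRel.unique pa pc h.la_pos h.lb_pos (BisectorRel.comm.1 Ra') Rb)
      (Or.inl d12.symm)
  · rw [← d12, ← d20, ← d01] at Rb'
    exact cyc (BisectorRel.unique pb pc h.la_pos h.lb_pos Ra (BisectorRel.comm.1 Rb'))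
      (Or.inr d20.symm)

lemma exactlyTwo (h : IsFamily la lb r) (hf : Realizes la r f F)
    (hx : ∃ s ∈ Ioo (0 : ℝ) 1, ∃ t ∈ Ioo (0 : ℝ) 1, s < t ∧ F s = x ∧ F t = x ∧
      ∀ u ∈ Ioo (0 : ℝ) 1, F u = x → u = s ∨ u = t) :
    ExactlyTwo (trianglesWith la lb f x) := by
  obtain ⟨s, hs, t, ht, hst, hsx, htx, huniq⟩ := hx
  obtain ⟨T₁, hT₁⟩ := h.exists_hasSides hs
  obtain ⟨T₂, hT₂⟩ := h.exists_hasSides ht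
  refine ⟨T₁, h.mem_trianglesWith hf hs hsx hT₁, T₂, h.mem_trianglesWith hf ht htx hT₂,
    h.not_congruent_comp hs ht hst hT₁ hT₂, fun T hT => ?_⟩
  obtain ⟨u, hu, huT, e⟩ := h.exists_of_mem_trianglesWith hf hT
  rcases huniq u hu e with rfl | rfl
  · exact Or.inl (huT.congruent hT₁)
  · exact Or.inr (huT.congruent hT₂)

end IsFamily

/-! ### Counting the solutions of `F s = x` for functions with one turning point or none -/

lemma exists_unique_root {F : ℝ → ℝ} {m s x : ℝ} (hl : InjOn F (Ioc 0 m))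
    (hs : s ∈ Ioo (0 : ℝ) 1) (hsm : s ≤ m) (hx : F s = x)
    (hr : ∀ u ∈ Ioo m 1, F u ≠ x) :
    ∃ s ∈ Ioo (0 : ℝ) 1, F s = x ∧ ∀ t ∈ Ioo (0 : ℝ) 1, F t = x → t = s := by
  refine ⟨s, hs, hx, fun t ht htx => ?_⟩
  rcases le_or_gt t m with htm | htm
  · exact hl ⟨ht.1, htm⟩ ⟨hs.1, hsm⟩ (htx.trans hx.symm)
  · exact absurd htx (hr t ⟨htm, ht.2⟩)

lemma exists_unique_root_right {F : ℝ → ℝ} {m s x : ℝ} (hr : InjOn F (Ico m 1))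
    (hs : s ∈ Ioo (0 : ℝ) 1) (hsm : m ≤ s) (hx : F s = x)
    (hl : ∀ u ∈ Ioo 0 m, F u ≠ x) :
    ∃ s ∈ Ioo (0 : ℝ) 1, F s = x ∧ ∀ t ∈ Ioo (0 : ℝ) 1, F t = x → t = s := by
  refine ⟨s, hs, hx, fun t ht htx => ?_⟩
  rcases le_or_gt m t with htm | htm
  · exact hr ⟨htm, ht.2⟩ ⟨hsm, hs.2⟩ (htx.trans hx.symm)
  · exact absurd htx (hl t ⟨ht.1, htm⟩)

lemma exists_two_roots {F : ℝ → ℝ} {m s t x : ℝ} (hl : InjOn F (Ioc 0 m))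
    (hr : InjOn F (Ico m 1)) (hs : s ∈ Ioo (0 : ℝ) m) (ht : t ∈ Ioo m 1) (hsx : F s = x)
    (htx : F t = x) :
    ∃ s ∈ Ioo (0 : ℝ) 1, ∃ t ∈ Ioo (0 : ℝ) 1, s < t ∧ F s = x ∧ F t = x ∧
      ∀ u ∈ Ioo (0 : ℝ) 1, F u = x → u = s ∨ u = t := by
  refine ⟨s, ⟨hs.1, (hs.2.trans ht.1).trans ht.2⟩, t, ⟨(hs.1.trans hs.2).trans ht.1, ht.2⟩,
    hs.2.trans ht.1, hsx, htx, fun u hu hux => ?_⟩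
  rcases le_or_gt u m with hum | hum
  · exact Or.inl (hl ⟨hu.1, hum⟩ ⟨hs.1, hs.2.le⟩ (hux.trans hsx.symm))
  · exact Or.inr (hr ⟨hum.le, hu.2⟩ ⟨ht.1.le, ht.2⟩ (hux.trans htx.symm))

/-- The numbers of solutions `s ∈ (0, 1)` of `F s = x` as for a height: none outside `(0, l]`, two
for `e < x < l`, and one otherwise. -/
structure HeightCount (F : ℝ → ℝ) (e l : ℝ) : Prop where
  two : ∀ x, e < x → x < l → ∃ s ∈ Ioo (0 : ℝ) 1, ∃ t ∈ Ioo (0 : ℝ) 1, s < t ∧ F s = x ∧ F t = x ∧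
    ∀ u ∈ Ioo (0 : ℝ) 1, F u = x → u = s ∨ u = t
  one : ∀ x, (0 < x ∧ x ≤ e) ∨ x = l →
    ∃ s ∈ Ioo (0 : ℝ) 1, F s = x ∧ ∀ t ∈ Ioo (0 : ℝ) 1, F t = x → t = s
  none : ∀ x, x ≤ 0 ∨ l < x → ∀ s ∈ Ioo (0 : ℝ) 1, F s ≠ x

lemma heightCount_sin {d : ℝ → ℝ} {l : ℝ} (hl : 0 < l) (hd : ContinuousOn d (Icc 0 1))
    (hmono : StrictMonoOn d (Icc 0 1)) (h0 : d 0 = 0) (h1 : Real.pi / 2 < d 1)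
    (h2 : d 1 < Real.pi) :
    HeightCount (fun s => l * Real.sin (d s)) (l * Real.sin (d 1)) l := by
  have i0 : (0 : ℝ) ∈ Icc (0 : ℝ) 1 := by norm_num
  have i1 : (1 : ℝ) ∈ Icc (0 : ℝ) 1 := by norm_num
  obtain ⟨m, hm, hdm⟩ := intermediate_value_Ioo zero_le_one hd
    (show Real.pi / 2 ∈ Ioo (d 0) (d 1) from ⟨by rw [h0]; exact Real.pi_div_two_pos, h1⟩)
  have hm' := Ioo_subset_Icc_self hm
  have hcont : ContinuousOn (fun s => l * Real.sin (d s)) (Icc 0 1) :=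
    continuousOn_const.mul (Real.continuous_sin.comp_continuousOn hd)
  have hleft : StrictMonoOn (fun s => l * Real.sin (d s)) (Icc 0 m) := by
    intro u hu v hv huv
    have hu' : u ∈ Icc (0 : ℝ) 1 := ⟨hu.1, hu.2.trans hm'.2⟩
    have hv' : v ∈ Icc (0 : ℝ) 1 := ⟨hv.1, hv.2.trans hm'.2⟩
    refine mul_lt_mul_of_pos_left (Real.sin_lt_sin_of_lt_of_le_pi_div_two ?_ ?_
      (hmono hu' hv' huv)) hl
    · have := hmono.monotoneOn i0 hu' hu'.1
      linarith [Real.pi_pos]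
    · rw [← hdm]
      exact hmono.monotoneOn hv' hm' hv.2
  have hright : StrictAntiOn (fun s => l * Real.sin (d s)) (Icc m 1) := by
    intro u hu v hv huv
    have hu' : u ∈ Icc (0 : ℝ) 1 := ⟨hm'.1.trans hu.1, hu.2⟩
    have hv' : v ∈ Icc (0 : ℝ) 1 := ⟨hm'.1.trans hv.1, hv.2⟩
    refine mul_lt_mul_of_pos_left ?_ hl
    rw [← Real.sin_pi_sub (d u), ← Real.sin_pi_sub (d v)]
    have a1 := hmono hu' hv' huv
    have a2 := hmono.monotoneOn hm' hu' hu.1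
    have a3 := hmono.monotoneOn hv' i1 hv'.2
    refine Real.sin_lt_sin_of_lt_of_le_pi_div_two ?_ ?_ ?_ <;> linarith [Real.pi_pos]
  have jl : InjOn (fun s => l * Real.sin (d s)) (Ioc 0 m) := hleft.injOn.mono Ioc_subset_Icc_self
  have jr : InjOn (fun s => l * Real.sin (d s)) (Ico m 1) := hright.injOn.mono Ico_subset_Icc_self
  have v0 : l * Real.sin (d 0) = 0 := by rw [h0, Real.sin_zero, mul_zero]
  have vm : l * Real.sin (d m) = l := by rw [hdm, Real.sin_pi_div_two, mul_one]
  have v1 : 0 < l * Real.sin (d 1) :=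
    mul_pos hl (Real.sin_pos_of_pos_of_lt_pi (by linarith [Real.pi_pos]) h2)
  have v1l : l * Real.sin (d 1) < l := by
    have := hright ⟨le_rfl, hm'.2⟩ ⟨hm'.2, le_rfl⟩ hm.2
    simp only at this
    rwa [vm] at this
  have rootl : ∀ x, 0 < x → x < l → ∃ u ∈ Ioo 0 m, l * Real.sin (d u) = x := by
    intro x hx hxl
    refine intermediate_value_Ioo hm'.1 (hcont.mono (Icc_subset_Icc_right hm'.2)) ?_
    simp only [v0, vm]
    exact ⟨hx, hxl⟩
  refine ⟨fun x hex hxl => ?_, fun x hx => ?_, fun x hx s hs hsx => ?_⟩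
  · obtain ⟨u, hu, hux⟩ := rootl x (v1.trans hex) hxl
    obtain ⟨v, hv, hvx⟩ : ∃ v ∈ Ioo m 1, l * Real.sin (d v) = x := by
      refine intermediate_value_Ioo' hm'.2 (hcont.mono (Icc_subset_Icc_left hm'.1)) ?_
      simp only [vm]
      exact ⟨hex, hxl⟩
    exact exists_two_roots jl jr hu hv hux hvx
  · rcases hx with ⟨hx, hxe⟩ | rfl
    · obtain ⟨u, hu, hux⟩ := rootl x hx (hxe.trans_lt v1l)
      -- The end `s = 1` is not a triangle: on the falling branch the values stay strictly above the
      -- end value, so `x ≤ e`, including `x = e`, is met on the rising branch only.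
      refine exists_unique_root jl ⟨hu.1, hu.2.trans hm.2⟩ hu.2.le hux fun v hv hvx => ?_
      have := hright ⟨hv.1.le, hv.2.le⟩ ⟨hm'.2, le_rfl⟩ hv.2
      simp only at this hvx
      linarith
    · refine exists_unique_root jl hm le_rfl vm fun v hv hvx => ?_
      have := hright ⟨le_rfl, hm'.2⟩ ⟨hv.1.le, hv.2.le⟩ hv.1
      simp only at this hvx
      linarith
  · have hs' := Ioo_subset_Icc_self hs
    have : 0 < l * Real.sin (d s) := by
      refine mul_pos hl (Real.sin_pos_of_pos_of_lt_pi ?_ ?_)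
      · have := hmono i0 hs' hs.1
        linarith
      · exact (hmono hs' i1 hs.2).trans h2
    have h3 : l * Real.sin (d s) ≤ l := by nlinarith [Real.sin_le_one (d s)]
    rcases hx with hx | hx <;> linarith

/-- The expression equals `(c / b - 1) (1 - b / c)`, and both factors shrink, remaining nonnegative,
as `b` and `c` approach each other. -/
lemma sq_sub_div_mul_lt {b b' c c' : ℝ} (hb : 0 < b) (hbb : b < b') (hbc : b' ≤ c')
    (hcc : c' < c) : (b' - c') ^ 2 / (b' * c') < (b - c) ^ 2 / (b * c) := by
  have hb' := hb.trans hbb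
  have hc' := hb'.trans_le hbc
  have hc := hc'.trans hcc
  have e : ∀ x y : ℝ, 0 < x → 0 < y → (x - y) ^ 2 / (x * y) = (y / x - 1) * (1 - x / y) := by
    intro x y hx hy
    field_simp
    ring
  rw [e b' c' hb' hc', e b c hb hc]
  have h1 : c' / b' < c / b := by
    rw [div_lt_div_iff₀ hb' hb]
    nlinarith
  have h2 : b / c < b' / c' := by
    rw [div_lt_div_iff₀ hc hc']
    nlinarith
  have h3 : 1 ≤ c' / b' := (one_le_div hb').2 hbc
  have h4 : b' / c' ≤ 1 := (div_le_one hc').2 hbc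
  exact mul_lt_mul'' (by linarith) (by linarith) (by linarith) (by linarith)

/-- The numbers of solutions `s ∈ (0, 1)` of `F s = x` as for a median: none below `l`, two
for `l < x < e`, and one otherwise. -/
structure MedianCount (F : ℝ → ℝ) (e l : ℝ) : Prop where
  two : ∀ x, l < x → x < e → ∃ s ∈ Ioo (0 : ℝ) 1, ∃ t ∈ Ioo (0 : ℝ) 1, s < t ∧ F s = x ∧ F t = x ∧
    ∀ u ∈ Ioo (0 : ℝ) 1, F u = x → u = s ∨ u = t
  one : ∀ x, e ≤ x ∨ x = l →
    ∃ s ∈ Ioo (0 : ℝ) 1, F s = x ∧ ∀ t ∈ Ioo (0 : ℝ) 1, F t = x → t = s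
  none : ∀ x, x < l → ∀ s ∈ Ioo (0 : ℝ) 1, F s ≠ x

lemma exists_gt_of_tendsto {b : ℝ → ℝ} (hb : Tendsto b (𝓝[<] 1) atTop) {m : ℝ} (hm : m < 1)
    (x : ℝ) : ∃ t ∈ Ioo m 1, x < b t :=
  (Filter.Eventually.and (Ioo_mem_nhdsLT hm) (hb.eventually_gt_atTop x)).exists

/-- The turning point is where `b = c`, with value `l`: before it the gap between `b` and `c`
narrows, after it the gap widens without bound. -/
lemma medianCount {F b c : ℝ → ℝ} {l : ℝ} (hl : 0 < l) (hF : ContinuousOn F (Ico 0 1))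
    (hb : ContinuousOn b (Ico 0 1)) (hc : ContinuousOn c (Ico 0 1))
    (hb0 : ∀ s ∈ Ico (0 : ℝ) 1, 0 < b s) (hc0 : ∀ s ∈ Ico (0 : ℝ) 1, 0 < c s)
    (hbm : StrictMonoOn b (Ico 0 1)) (hcm : StrictAntiOn c (Ico 0 1))
    (hbt : Tendsto b (𝓝[<] 1) atTop) (hbc : b 0 < c 0) (hF0 : ∀ s ∈ Ico (0 : ℝ) 1, 0 ≤ F s)
    (hFe : ∀ s ∈ Ico (0 : ℝ) 1, 4 * F s ^ 2 =
      4 * l ^ 2 + (b s - c s) ^ 2 + l ^ 2 * ((b s - c s) ^ 2 / (b s * c s))) :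
    MedianCount F (F 0) l := by
  have i0 : (0 : ℝ) ∈ Ico (0 : ℝ) 1 := by norm_num
  have hl2 : 0 < l ^ 2 := by positivity
  obtain ⟨m, hm, hbcm⟩ : ∃ m ∈ Ioo (0 : ℝ) 1, b m = c m := by
    obtain ⟨t, ht, hbt⟩ := exists_gt_of_tendsto hbt zero_lt_one (c 0)
    have hsub : Icc 0 t ⊆ Ico (0 : ℝ) 1 := fun u hu => ⟨hu.1, hu.2.trans_lt ht.2⟩
    have hct := hcm i0 (Ioo_subset_Ico_self ht) ht.1
    obtain ⟨m, hm, hmm⟩ := intermediate_value_Ioo ht.1.le ((hb.sub hc).mono hsub)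
      (show (0 : ℝ) ∈ Ioo _ _ from ⟨sub_neg.2 hbc, sub_pos.2 (hct.trans hbt)⟩)
    exact ⟨m, ⟨hm.1, hm.2.trans ht.2⟩, sub_eq_zero.1 hmm⟩
  have hm' := Ioo_subset_Ico_self hm
  have lt_of : ∀ u ∈ Ico (0 : ℝ) 1, ∀ v ∈ Ico (0 : ℝ) 1, (b u - c u) ^ 2 < (b v - c v) ^ 2 →
      (b u - c u) ^ 2 / (b u * c u) < (b v - c v) ^ 2 / (b v * c v) → F u < F v := by
    intro u hu v hv h1 h2
    refine lt_of_pow_lt_pow_left₀ 2 (hF0 v hv) ?_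
    nlinarith [hFe u hu, hFe v hv, mul_lt_mul_of_pos_left h2 hl2]
  have hleft : StrictAntiOn F (Icc 0 m) := by
    intro u hu v hv huv
    have hu' : u ∈ Ico (0 : ℝ) 1 := ⟨hu.1, hu.2.trans_lt hm.2⟩
    have hv' : v ∈ Ico (0 : ℝ) 1 := ⟨hv.1, hv.2.trans_lt hm.2⟩
    have b1 := hbm hu' hv' huv
    have c1 := hcm hu' hv' huv
    have bc : b v ≤ c v :=
      (hbm.monotoneOn hv' hm' hv.2).trans (hbcm.trans_le (hcm.antitoneOn hv' hm' hv.2))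
    exact lt_of v hv' u hu' (by nlinarith) (sq_sub_div_mul_lt (hb0 u hu') b1 bc c1)
  have hright : StrictMonoOn F (Ico m 1) := by
    intro u hu v hv huv
    have hu' : u ∈ Ico (0 : ℝ) 1 := ⟨hm'.1.trans hu.1, hu.2⟩
    have hv' : v ∈ Ico (0 : ℝ) 1 := ⟨hm'.1.trans hv.1, hv.2⟩
    have b1 := hbm hu' hv' huv
    have c1 := hcm hu' hv' huv
    have bc : c u ≤ b u :=
      (hcm.antitoneOn hm' hu' hu.1).trans (hbcm.symm.trans_le (hbm.monotoneOn hm' hu' hu.1))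
    refine lt_of u hu' v hv' (by nlinarith) ?_
    have := sq_sub_div_mul_lt (hc0 v hv') c1 bc b1
    rwa [mul_comm (c u), mul_comm (c v), ← neg_sub (b u), ← neg_sub (b v), neg_sq, neg_sq] at this
  have jl : InjOn F (Ioc 0 m) := hleft.injOn.mono Ioc_subset_Icc_self
  have jr : InjOn F (Ico m 1) := hright.injOn
  have vm : F m = l := by
    refine (pow_left_inj₀ (hF0 m hm') hl.le two_ne_zero).1 ?_
    have := hFe m hm'
    rw [hbcm, sub_self] at this
    simp only [ne_eq, OfNat.ofNat_ne_zero, not_false_eq_true, zero_pow, zero_div, mul_zero,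
      add_zero] at this
    linarith
  have v0 : l < F 0 := by
    rw [← vm]
    exact hleft ⟨le_rfl, hm.1.le⟩ ⟨hm.1.le, le_rfl⟩ hm.1
  have rootr : ∀ x, l < x → ∃ u ∈ Ioo m 1, F u = x := by
    intro x hx
    -- Since `c t < c 0`, this choice gives `b t - c t > 2 x`, and `4 F²` is at least `(b - c)²`.
    obtain ⟨t, ht, hbt⟩ := exists_gt_of_tendsto hbt hm.2 (c 0 + 2 * x)
    have ht' : t ∈ Ioo (0 : ℝ) 1 := ⟨hm.1.trans ht.1, ht.2⟩
    have htI := Ioo_subset_Ico_self ht'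
    have hct := hcm i0 htI ht'.1
    have hxt : x < F t := by
      refine lt_of_pow_lt_pow_left₀ 2 (hF0 t htI) ?_
      have h1 : 0 ≤ l ^ 2 * ((b t - c t) ^ 2 / (b t * c t)) := by
        have := hb0 t htI
        have := hc0 t htI
        positivity
      have h2 : (2 * x) ^ 2 < (b t - c t) ^ 2 :=
        pow_lt_pow_left₀ (by linarith) (by linarith) two_ne_zero
      nlinarith [hFe t htI]
    obtain ⟨u, hu, hux⟩ := intermediate_value_Ioo ht.1.le
      (hF.mono fun u hu => ⟨hm.1.le.trans hu.1, hu.2.trans_lt ht.2⟩)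
      (show x ∈ Ioo (F m) (F t) from ⟨vm.symm ▸ hx, hxt⟩)
    exact ⟨u, ⟨hu.1, hu.2.trans ht.2⟩, hux⟩
  refine ⟨fun x hlx hxe => ?_, fun x hx => ?_, fun x hx s hs hsx => ?_⟩
  · obtain ⟨v, hv, hvx⟩ := rootr x hlx
    obtain ⟨u, hu, hux⟩ := intermediate_value_Ioo' hm.1.le
      (hF.mono fun u hu => ⟨hu.1, hu.2.trans_lt hm.2⟩)
      (show x ∈ Ioo (F m) (F 0) from ⟨vm.symm ▸ hlx, hxe⟩)
    exact exists_two_roots jl jr hu hv hux hvx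
  · rcases hx with hx | rfl
    · obtain ⟨v, hv, hvx⟩ := rootr x (v0.trans_le hx)
      -- The value `F 0` belongs to the degenerate end and is not attained for `s > 0` on the
      -- falling branch, so `x = F 0` has only the root on the right.
      refine exists_unique_root_right jr ⟨hm.1.trans hv.1, hv.2⟩ hv.1.le hvx fun u hu hux => ?_
      have := hleft ⟨le_rfl, hm.1.le⟩ ⟨hu.1.le, hu.2.le⟩ hu.1
      linarith
    · refine exists_unique_root_right jr hm le_rfl vm fun u hu hux => ?_
      have := hleft ⟨hu.1.le, hu.2.le⟩ ⟨hm.1.le, le_rfl⟩ hu.2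
      linarith
  · have : l ≤ F s := by
      rw [← vm]
      rcases le_or_gt s m with h | h
      · exact hleft.antitoneOn ⟨hs.1.le, h⟩ ⟨hm.1.le, le_rfl⟩ h
      · exact hright.monotoneOn ⟨le_rfl, hm.2⟩ ⟨h.le, hs.2⟩ h.le
    linarith

lemma exists_unique_root_of_strictMonoOn {F : ℝ → ℝ} (hF : ContinuousOn F (Ico 0 1))
    (hm : StrictMonoOn F (Ico 0 1)) {x : ℝ} (h0 : F 0 < x) (ht : ∃ t ∈ Ico (0 : ℝ) 1, x < F t) :
    ∃ s ∈ Ioo (0 : ℝ) 1, F s = x ∧ ∀ t ∈ Ioo (0 : ℝ) 1, F t = x → t = s := by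
  obtain ⟨t, ht, hxt⟩ := ht
  obtain ⟨s, hs, hsx⟩ := intermediate_value_Ioo ht.1
    (hF.mono fun u hu => ⟨hu.1, hu.2.trans_lt ht.2⟩) (show x ∈ Ioo (F 0) (F t) from ⟨h0, hxt⟩)
  have hs' : s ∈ Ioo (0 : ℝ) 1 := ⟨hs.1, hs.2.trans ht.2⟩
  exact ⟨s, hs', hsx, fun u hu hux => hm.injOn (Ioo_subset_Ico_self hu) (Ioo_subset_Ico_self hs')
    (hux.trans hsx.symm)⟩

/-! ### The heights along the family -/

lemma sin_arctan_add_two_mul_arctan_sq (u v : ℝ) :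
    Real.sin (Real.arctan u + 2 * Real.arctan v) ^ 2 =
      (u * (1 - v ^ 2) + 2 * v) ^ 2 / ((1 + u ^ 2) * (1 + v ^ 2) ^ 2) := by
  have hs : ∀ x, Real.sin (Real.arctan x) = x * Real.cos (Real.arctan x) := by
    intro x
    rw [Real.sin_arctan, Real.cos_arctan]
    ring
  have hu := Real.cos_sq_arctan u
  have hv := Real.cos_sq_arctan v
  have e : Real.sin (Real.arctan u + 2 * Real.arctan v) =
      Real.cos (Real.arctan u) * Real.cos (Real.arctan v) ^ 2 * (u * (1 - v ^ 2) + 2 * v) := by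
    rw [Real.sin_add, Real.sin_two_mul, Real.cos_two_mul', hs, hs]
    ring
  rw [e, mul_pow, mul_pow, hu, hv]
  field_simp

/-- The sum of half the angle at `A` and the angle at `B`. -/
noncomputable def bisectorAngle (r : ℝ → ℝ) (s : ℝ) : ℝ :=
  Real.arctan √(s / r s) + 2 * Real.arctan √(s * r s)

namespace IsFamily

variable {la lb : ℝ} {r : ℝ → ℝ}

lemma apply_one (h : IsFamily la lb r) : r 1 = la ^ 2 / lb ^ 2 := by
  have h1 : (1 : ℝ) ∈ Icc (0 : ℝ) 1 := by norm_num
  have h2 := h.pos 1 h1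
  have h3 := h.eq 1 h1
  have h4 := h.lb_pos
  have e1 : ratioA (r 1) 1 = 4 * r 1 / (1 + r 1) := by
    rw [ratioA, show 1 + (2 - 1) * r 1 = 1 + r 1 by ring]
    field_simp
    ring
  have e2 : ratioB (r 1) 1 = 4 / (1 + r 1) := by
    rw [ratioB, show 2 - 1 + r 1 = 1 + r 1 by ring]
    field_simp
  rw [e1, e2] at h3
  field_simp at h3
  rw [eq_div_iff (by positivity)]
  linarith

lemma strictMonoOn_sqrt_mul (h : IsFamily la lb r) :
    StrictMonoOn (fun s => √(s * r s)) (Icc 0 1) := fun _ hs _ ht hst =>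
  Real.sqrt_lt_sqrt (mul_nonneg hs.1 (h.pos _ hs).le) (h.strictMonoOn_mul hs ht hst)

lemma strictMonoOn_bisectorAngle (h : IsFamily la lb r) :
    StrictMonoOn (bisectorAngle r) (Icc 0 1) := by
  intro s hs t ht hst
  have h1 := Real.arctan_strictMono (h.strictMonoOn_sqrt_mul hs ht hst)
  have h2 := Real.arctan_strictMono (h.swap.strictMonoOn_sqrt_mul hs ht hst)
  simp only [← div_eq_mul_inv] at h2
  unfold bisectorAngle
  linarith

lemma continuousOn_bisectorAngle (h : IsFamily la lb r) :
    ContinuousOn (bisectorAngle r) (Icc 0 1) := by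
  have h1 := h.continuousOn
  have h2 : ContinuousOn (fun s => s / r s) (Icc 0 1) :=
    continuousOn_id.div h1 fun s hs => (h.pos s hs).ne'
  unfold bisectorAngle
  exact (Real.continuous_arctan.comp_continuousOn h2.sqrt).add (continuousOn_const.mul
    (Real.continuous_arctan.comp_continuousOn (continuousOn_id.mul h1).sqrt))

lemma bisectorAngle_zero : bisectorAngle r 0 = 0 := by
  simp [bisectorAngle]

lemma bisectorAngle_one (h : IsFamily la lb r) :
    bisectorAngle r 1 = Real.pi / 2 + Real.arctan √(r 1) := by
  have h2 := h.pos 1 (by norm_num)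
  rw [bisectorAngle, one_mul, one_div, Real.sqrt_inv,
    Real.arctan_inv_of_pos (Real.sqrt_pos.2 h2)]
  ring

lemma mul_sin_bisectorAngle_one (h : IsFamily la lb r) :
    la * Real.sin (bisectorAngle r 1) = hStarStar la lb := by
  have ha := h.la_pos
  have hb := h.lb_pos
  rw [h.bisectorAngle_one, add_comm, Real.sin_add_pi_div_two, Real.cos_arctan,
    Real.sq_sqrt (h.pos 1 (by norm_num)).le, h.apply_one, hStarStar,
    show 1 + la ^ 2 / lb ^ 2 = (la ^ 2 + lb ^ 2) / lb ^ 2 by field_simp; ring,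
    Real.sqrt_div (by positivity), Real.sqrt_sq hb.le]
  field_simp

lemma heightCount (h : IsFamily la lb r) :
    HeightCount (fun s => la * Real.sin (bisectorAngle r s)) (hStarStar la lb) la := by
  have h1 := h.bisectorAngle_one
  have h2 : 0 < Real.arctan √(r 1) :=
    Real.arctan_pos.2 (Real.sqrt_pos.2 (h.pos 1 (by norm_num)))
  have h3 := Real.arctan_lt_pi_div_two √(r 1)
  rw [← h.mul_sin_bisectorAngle_one]
  exact heightCount_sin h.la_pos h.continuousOn_bisectorAngle h.strictMonoOn_bisectorAngle
    bisectorAngle_zero (by linarith) (by linarith)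

/-- The bisector from `A` meets the line `BC` at the angle `A/2 + B` or its supplement, so the
height is `la` times its sine. The proof compares squares, which is why the sine is first shown to
be nonnegative. -/
lemma height_eq_mul_sin (h : IsFamily la lb r) {s H : ℝ} (hs : s ∈ Ioo (0 : ℝ) 1) (hH : 0 < H)
    (e : 4 * sideA la r s ^ 2 * H ^ 2 = 4 * sideA la r s ^ 2 * sideC la r s ^ 2 -
      (sideA la r s ^ 2 + sideC la r s ^ 2 - sideB la r s ^ 2) ^ 2) :
    H = la * Real.sin (bisectorAngle r s) := by
  have hs' := Ioo_subset_Icc_self hs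
  have i0 : (0 : ℝ) ∈ Icc (0 : ℝ) 1 := by norm_num
  have i1 : (1 : ℝ) ∈ Icc (0 : ℝ) 1 := by norm_num
  have hr := h.pos s hs'
  have hc := h.sideC_pos hs'
  have ha := h.sideA_pos (Ioo_subset_Ico_self hs)
  have h0 := hs.1
  have h1 : 0 < 1 - s := sub_pos.2 hs.2
  have hk : 0 < 2 - s := by linarith
  have hsin : 0 ≤ Real.sin (bisectorAngle r s) := by
    have m0 := h.strictMonoOn_bisectorAngle i0 hs' hs.1
    have m1 := h.strictMonoOn_bisectorAngle hs' i1 hs.2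
    rw [bisectorAngle_zero] at m0
    rw [h.bisectorAngle_one] at m1
    exact Real.sin_nonneg_of_nonneg_of_le_pi m0.le
      (by linarith [Real.arctan_lt_pi_div_two √(r 1)])
  refine (pow_left_inj₀ hH.le (mul_nonneg h.la_pos.le hsin) two_ne_zero).1 ?_
  have hu : √(s / r s) ^ 2 = s / r s := Real.sq_sqrt (by positivity)
  have hv : √(s * r s) ^ 2 = s * r s := Real.sq_sqrt (by positivity)
  have huv : √(s / r s) * √(s * r s) = s := by
    rw [← Real.sqrt_mul (by positivity), show s / r s * (s * r s) = s ^ 2 by field_simp,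
      Real.sqrt_sq h0.le]
  have hsq : Real.sin (bisectorAngle r s) ^ 2 =
      s * (1 + (2 - s) * r s) ^ 2 / ((r s + s) * (1 + s * r s) ^ 2) := by
    rw [bisectorAngle, sin_arctan_add_two_mul_arctan_sq, hu, hv,
      show (√(s / r s) * (1 - s * r s) + 2 * √(s * r s)) ^ 2 =
        √(s / r s) ^ 2 * (1 - s * r s) ^ 2 + 4 * (√(s / r s) * √(s * r s)) * (1 - s * r s) +
          4 * √(s * r s) ^ 2 by ring, hu, hv, huv]
    field_simp
    ring
  have hH2 : H ^ 2 = sideC la r s ^ 2 * (4 * s * r s / (1 + s * r s) ^ 2) := by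
    have : 4 * sideA la r s ^ 2 ≠ 0 := by positivity
    refine mul_left_cancel₀ this (e.trans ?_)
    rw [sideA, sideB]
    generalize sideC la r s = c at *
    generalize r s = x at *
    field_simp
    ring
  rw [hH2, mul_pow, hsq, ← h.sideC_sq_mul_ratioA hs', ratioA]
  field_simp

lemma realizes_height_zero (h : IsFamily la lb r) :
    Realizes la r (fun T => T.height 0) (fun s => la * Real.sin (bisectorAngle r s)) :=
  fun _ hs T hT => h.height_eq_mul_sin hs (T.height_pos 0) hT.height_zero

lemma realizes_height_one (h : IsFamily la lb r) :
    Realizes la r (fun T => T.height 1)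
      (fun s => lb * Real.sin (bisectorAngle (fun s => (r s)⁻¹) s)) := by
  intro s hs T hT
  have hs' := Ioo_subset_Icc_self hs
  refine h.swap.height_eq_mul_sin hs (T.height_pos 1) ?_
  rw [h.sideA_swap hs', h.sideB_swap hs', h.sideC_swap hs', hT.height_one]
  ring

/-- The height from `C` in the member of a family with parameter `s`. -/
noncomputable def heightC (la : ℝ) (r : ℝ → ℝ) (s : ℝ) : ℝ :=
  sideA la r s * (2 * √(s * r s) / (1 + s * r s))

lemma realizes_height_two (h : IsFamily la lb r) :
    Realizes la r (fun T => T.height 2) (heightC la r) := by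
  intro s hs T hT
  have hs' := Ioo_subset_Icc_self hs
  have hr := h.pos s hs'
  have hc := h.sideC_pos hs'
  have ha := h.sideA_pos (Ioo_subset_Ico_self hs)
  have h0 := hs.1
  have h1 : 0 < 1 - s := sub_pos.2 hs.2
  have hv : √(s * r s) ^ 2 = s * r s := Real.sq_sqrt (by positivity)
  refine (pow_left_inj₀ (T.height_pos 2).le (by unfold heightC; positivity) two_ne_zero).1 ?_
  have : 4 * sideC la r s ^ 2 ≠ 0 := by positivity
  refine mul_left_cancel₀ this (hT.height_two.trans ?_)
  rw [heightC, mul_pow, div_pow, mul_pow, hv, sideA, sideB]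
  generalize sideC la r s = c at *
  generalize r s = x at *
  field_simp
  ring

/-- The factor is `sin B` written in `v = tan(B/2)`. It increases as long as `v ≤ 1`, and `la ≤ lb`
ensures this, since `v²` is bounded by its end value `r 1 = la² / lb²`. -/
lemma strictMonoOn_heightC_factor (h : IsFamily la lb r) (hab : la ≤ lb) :
    StrictMonoOn (fun s => 2 * √(s * r s) / (1 + s * r s)) (Icc 0 1) := by
  have i1 : (1 : ℝ) ∈ Icc (0 : ℝ) 1 := by norm_num
  intro s hs t ht hst
  have hs0 := mul_nonneg hs.1 (h.pos s hs).le
  have ht0 := mul_nonneg ht.1 (h.pos t ht).le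
  have hlt : √(s * r s) < √(t * r t) := h.strictMonoOn_sqrt_mul hs ht hst
  have hle : √(t * r t) ≤ 1 := by
    refine Real.sqrt_le_one.2 ((h.strictMonoOn_mul.monotoneOn ht i1 ht.2).trans ?_)
    simp only [one_mul]
    rw [h.apply_one, div_le_one (pow_pos h.lb_pos 2)]
    exact pow_le_pow_left₀ h.la_pos.le hab 2
  simp only
  rw [div_lt_div_iff₀ (by positivity) (by positivity)]
  have e1 := Real.sq_sqrt hs0
  have e2 := Real.sq_sqrt ht0
  have p1 := Real.sqrt_nonneg (s * r s)
  have hlt1 : √(s * r s) * √(t * r t) < 1 := by nlinarith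
  rw [← e1, ← e2, Real.sqrt_sq p1, Real.sqrt_sq (p1.trans hlt.le)]
  nlinarith [mul_pos (sub_pos.2 hlt) (sub_pos.2 hlt1)]

lemma strictMonoOn_heightC (h : IsFamily la lb r) (hab : la ≤ lb) :
    StrictMonoOn (heightC la r) (Ico 0 1) := by
  intro s hs t ht hst
  have hs' := Ico_subset_Icc_self hs
  have hs0 := mul_nonneg hs.1 (h.pos s hs').le
  exact mul_lt_mul'' (h.strictMonoOn_sideA hs ht hst)
    (h.strictMonoOn_heightC_factor hab hs' (Ico_subset_Icc_self ht) hst)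
    (h.sideA_pos hs).le (by positivity)

lemma heightC_zero : heightC la r 0 = 0 := by
  simp [heightC]

lemma continuousOn_heightC (h : IsFamily la lb r) : ContinuousOn (heightC la r) (Ico 0 1) := by
  have h1 := h.continuousOn.mono (Ico_subset_Icc_self : Ico (0 : ℝ) 1 ⊆ _)
  have h2 := h.continuousOn_sideA
  unfold heightC
  refine h2.mul (ContinuousOn.div (by fun_prop) (by fun_prop) fun s hs => ?_)
  have := mul_nonneg hs.1 (h.pos s (Ico_subset_Icc_self hs)).le
  positivity

lemma exists_lt_heightC (h : IsFamily la lb r) (hab : la ≤ lb) (x : ℝ) :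
    ∃ t ∈ Ico (0 : ℝ) 1, x < heightC la r t := by
  have i2 : (1 / 2 : ℝ) ∈ Icc (0 : ℝ) 1 := by norm_num
  set g : ℝ := 2 * √(1 / 2 * r (1 / 2)) / (1 + 1 / 2 * r (1 / 2)) with hgdef
  have hg : 0 < g := by
    have := h.pos _ i2
    positivity
  obtain ⟨t, ht, hxt⟩ := exists_gt_of_tendsto h.tendsto_sideA (show (1 / 2 : ℝ) < 1 by norm_num)
    (x / g)
  have ht' : t ∈ Ico (0 : ℝ) 1 := ⟨by linarith [ht.1], ht.2⟩
  refine ⟨t, ht', ?_⟩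
  have h2 := h.strictMonoOn_heightC_factor hab i2 (Ico_subset_Icc_self ht') ht.1
  calc x < sideA la r t * g := by rwa [div_lt_iff₀ hg] at hxt
    _ ≤ heightC la r t := mul_le_mul_of_nonneg_left h2.le (h.sideA_pos ht').le

/-! ### The medians along the family -/

/-- The median to the side `a` of a triangle with sides `a`, `b`, `c`. -/
noncomputable def medianOfSides (a b c : ℝ) : ℝ := √(2 * b ^ 2 + 2 * c ^ 2 - a ^ 2) / 2

lemma eq_medianOfSides {a b c m : ℝ} (hm : 0 ≤ m)
    (e : 4 * m ^ 2 = 2 * b ^ 2 + 2 * c ^ 2 - a ^ 2) : m = medianOfSides a b c := by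
  rw [medianOfSides, ← e, show 4 * m ^ 2 = (2 * m) ^ 2 by ring, Real.sqrt_sq (by positivity)]
  ring

lemma sq_medianOfSides {a b c : ℝ} (h : 0 ≤ 2 * b ^ 2 + 2 * c ^ 2 - a ^ 2) :
    4 * medianOfSides a b c ^ 2 = 2 * b ^ 2 + 2 * c ^ 2 - a ^ 2 := by
  rw [medianOfSides, div_pow, Real.sq_sqrt h]
  ring

lemma realizes_median_zero : Realizes la r (fun T => medianLength T 0)
    (fun s => medianOfSides (sideA la r s) (sideB la r s) (sideC la r s)) :=
  fun _ _ _ hT => eq_medianOfSides dist_nonneg hT.median_zero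

lemma realizes_median_one : Realizes la r (fun T => medianLength T 1)
    (fun s => medianOfSides (sideB la r s) (sideA la r s) (sideC la r s)) :=
  fun _ _ _ hT => eq_medianOfSides dist_nonneg hT.median_one

lemma realizes_median_two : Realizes la r (fun T => medianLength T 2)
    (fun s => medianOfSides (sideC la r s) (sideA la r s) (sideB la r s)) :=
  fun _ _ _ hT => eq_medianOfSides dist_nonneg hT.median_two

lemma sideA_add_sideB_zero (h : IsFamily la lb r) :
    sideA la r 0 + sideB la r 0 = sideC la r 0 := by
  have := h.sideA_add_sideB_sub (s := 0) (by norm_num)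
  simp only [mul_zero, zero_div] at this
  linarith

lemma medianCount_sideA (h : IsFamily la lb r) :
    MedianCount (fun s => medianOfSides (sideA la r s) (sideB la r s) (sideC la r s))
      (sideB la r 0 + sideA la r 0 / 2) la := by
  have i0 : (0 : ℝ) ∈ Ico (0 : ℝ) 1 := by norm_num
  have e0 : medianOfSides (sideA la r 0) (sideB la r 0) (sideC la r 0) =
      sideB la r 0 + sideA la r 0 / 2 := by
    have := h.sideA_pos i0
    have := h.sideB_pos i0
    refine (eq_medianOfSides (by positivity) ?_).symm
    rw [← h.sideA_add_sideB_zero]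
    ring
  rw [← e0]
  have hA := h.continuousOn_sideA
  have hB := h.continuousOn_sideB
  have hC := h.continuousOn_sideC.mono (Ico_subset_Icc_self : Ico (0 : ℝ) 1 ⊆ _)
  refine medianCount (b := sideB la r) (c := sideC la r) h.la_pos ?_ hB hC
    (fun s hs => h.sideB_pos hs) (fun s hs => h.sideC_pos (Ico_subset_Icc_self hs))
    h.strictMonoOn_sideB (h.strictAntiOn_sideC.mono Ico_subset_Icc_self) h.tendsto_sideB
    ?_ (fun s hs => by unfold medianOfSides; positivity) fun s hs => ?_
  · unfold medianOfSides
    fun_prop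
  · linarith [h.sideA_add_sideB_zero, h.sideA_pos i0]
  · have ha := h.sideA_pos hs
    have hb := h.sideB_pos hs
    have hc := h.sideC_pos (Ico_subset_Icc_self hs)
    have hlt := h.sideA_lt hs
    -- Eliminating `a²` from the median formula by the bisector relation leaves an expression in
    -- `b`, `c` and `la` alone.
    have e : la ^ 2 * (sideB la r s + sideC la r s) ^ 2 = _ := h.bisectorRel_sideA hs
    rw [sq_medianOfSides (by nlinarith [sq_nonneg (sideB la r s - sideC la r s)])]
    field_simp
    linear_combination -e

lemma medianCount_sideB (h : IsFamily la lb r) :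
    MedianCount (fun s => medianOfSides (sideB la r s) (sideA la r s) (sideC la r s))
      (sideA la r 0 + sideB la r 0 / 2) lb := by
  have i0 : (0 : ℝ) ∈ Icc (0 : ℝ) 1 := by norm_num
  have hm := h.swap.medianCount_sideA
  rw [h.sideA_swap i0, h.sideB_swap i0] at hm
  have e : ∀ s ∈ Ioo (0 : ℝ) 1, medianOfSides (sideA lb (fun s => (r s)⁻¹) s)
      (sideB lb (fun s => (r s)⁻¹) s) (sideC lb (fun s => (r s)⁻¹) s) =
      medianOfSides (sideB la r s) (sideA la r s) (sideC la r s) := by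
    intro s hs
    have hs' := Ioo_subset_Icc_self hs
    rw [h.sideA_swap hs', h.sideB_swap hs', h.sideC_swap hs']
  refine ⟨fun x h1 h2 => ?_, fun x h1 => ?_, fun x h1 s hs => ?_⟩
  · obtain ⟨s, hs, t, ht, hst, hsx, htx, hu⟩ := hm.two x h1 h2
    exact ⟨s, hs, t, ht, hst, (e s hs).symm.trans hsx, (e t ht).symm.trans htx,
      fun u hu' hux => hu u hu' ((e u hu').trans hux)⟩
  · obtain ⟨s, hs, hsx, hu⟩ := hm.one x h1
    exact ⟨s, hs, (e s hs).symm.trans hsx, fun u hu' hux => hu u hu' ((e u hu').trans hux)⟩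
  · have := hm.none x h1 s hs
    simp only [e s hs] at this
    exact this

lemma medianC_radicand_nonneg (h : IsFamily la lb r) {s : ℝ} (hs : s ∈ Ico (0 : ℝ) 1) :
    0 ≤ 2 * sideA la r s ^ 2 + 2 * sideB la r s ^ 2 - sideC la r s ^ 2 := by
  have ha := h.sideA_pos hs
  have hb := h.sideB_pos hs
  have hc := h.sideC_pos (Ico_subset_Icc_self hs)
  have : sideC la r s ≤ sideA la r s + sideB la r s := by
    have h1 := h.sideA_add_sideB_sub hs
    have h2 : 0 ≤ 2 * sideC la r s * s / (1 - s) :=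
      div_nonneg (mul_nonneg (by positivity) hs.1) (sub_nonneg.2 hs.2.le)
    linarith
  nlinarith [sq_nonneg (sideA la r s - sideB la r s)]

lemma strictMonoOn_medianC (h : IsFamily la lb r) : StrictMonoOn
    (fun s => medianOfSides (sideC la r s) (sideA la r s) (sideB la r s)) (Ico 0 1) := by
  intro s hs t ht hst
  have ha := pow_lt_pow_left₀ (h.strictMonoOn_sideA hs ht hst) (h.sideA_pos hs).le two_ne_zero
  have hb := pow_lt_pow_left₀ (h.strictMonoOn_sideB hs ht hst) (h.sideB_pos hs).le two_ne_zero
  have hc := pow_lt_pow_left₀ (h.strictAntiOn_sideC (Ico_subset_Icc_self hs)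
    (Ico_subset_Icc_self ht) hst) (h.sideC_pos (Ico_subset_Icc_self ht)).le two_ne_zero
  simp only [medianOfSides]
  have := Real.sqrt_lt_sqrt (h.medianC_radicand_nonneg hs)
    (show _ < 2 * sideA la r t ^ 2 + 2 * sideB la r t ^ 2 - sideC la r t ^ 2 by linarith)
  linarith

lemma continuousOn_medianC (h : IsFamily la lb r) : ContinuousOn
    (fun s => medianOfSides (sideC la r s) (sideA la r s) (sideB la r s)) (Ico 0 1) := by
  have hA := h.continuousOn_sideA
  have hB := h.continuousOn_sideB
  have hC := h.continuousOn_sideC.mono (Ico_subset_Icc_self : Ico (0 : ℝ) 1 ⊆ _)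
  unfold medianOfSides
  fun_prop

lemma exists_lt_medianC (h : IsFamily la lb r) (x : ℝ) : ∃ t ∈ Ico (0 : ℝ) 1,
    x < medianOfSides (sideC la r t) (sideA la r t) (sideB la r t) := by
  obtain ⟨t, ht, hxt⟩ := exists_gt_of_tendsto h.tendsto_sideA zero_lt_one
    (sideC la r 0 + 2 * |x|)
  have ht' := Ioo_subset_Ico_self ht
  refine ⟨t, ht', (le_abs_self x).trans_lt (lt_of_pow_lt_pow_left₀ 2
    (by unfold medianOfSides; positivity) ?_)⟩
  have hc := h.strictAntiOn_sideC (by norm_num) (Ioo_subset_Icc_self ht) ht.1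
  have hc0 := h.sideC_pos (Ioo_subset_Icc_self ht)
  have := sq_medianOfSides (h.medianC_radicand_nonneg ht')
  have := abs_nonneg x
  nlinarith [sq_nonneg (sideB la r t)]

/-! ### The degenerate end `s = 0` and the starred constants -/

lemma sideC_zero (h : IsFamily la lb r) : sideC la r 0 = cStar la lb := by
  have i0 : (0 : ℝ) ∈ Icc (0 : ℝ) 1 := by norm_num
  have ha := h.la_pos
  have hb := h.lb_pos
  have hr := h.pos 0 i0
  have hc := h.sideC_pos i0
  have e1 : sideC la r 0 * (2 * r 0) = la * (1 + 2 * r 0) := by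
    refine (pow_left_inj₀ (by positivity) (by positivity) two_ne_zero).1 ?_
    rw [mul_pow la, ← h.sideC_sq_mul_ratioA i0, ratioA]
    simp only [add_zero, sub_zero]
    field_simp
    ring
  have e2 : sideC la r 0 * 2 = lb * (2 + r 0) := by
    refine (pow_left_inj₀ (by positivity) (by positivity) two_ne_zero).1 ?_
    rw [mul_pow lb, ← h.sideC_sq_mul_ratioB i0, ratioB]
    simp only [add_zero, sub_zero, mul_zero]
    field_simp
    ring
  generalize sideC la r 0 = c at *
  generalize r 0 = x at *
  have hla : la < c := by nlinarith
  have hlb : lb < c := by nlinarith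
  -- Eliminating `r 0` leaves a quadratic equation for `c`; the bounds `la < c` and `lb < c` select
  -- its larger root.
  have e3 : 4 * c ^ 2 - 4 * c * (la + lb) + 3 * (la * lb) = 0 := by
    have e4 : (c - la) * (2 * x) = la := by linear_combination e1
    have e5 : lb * x = 2 * c - 2 * lb := by linear_combination -e2
    linear_combination lb * e4 - 2 * (c - la) * e5
  have e6 : √(la ^ 2 + lb ^ 2 - la * lb) = 2 * c - la - lb := by
    rw [show la ^ 2 + lb ^ 2 - la * lb = (2 * c - la - lb) ^ 2 by linear_combination -e3]
    exact Real.sqrt_sq (by linarith)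
  rw [cStar, e6]
  ring

lemma sideA_zero (h : IsFamily la lb r) : sideA la r 0 = aStar la lb := by
  have i0 : (0 : ℝ) ∈ Icc (0 : ℝ) 1 := by norm_num
  have i0' : (0 : ℝ) ∈ Ico (0 : ℝ) 1 := by norm_num
  have hb := h.lb_pos
  have ha := h.sideA_pos i0'
  have hc := h.sideC_pos i0
  have e := h.inv_sideA_add_inv_sideC i0'
  have e1 : ((sideA la r 0)⁻¹ + (sideC la r 0)⁻¹) * lb = 2 := by
    refine (pow_left_inj₀ (by positivity) (by norm_num) two_ne_zero).1 ?_
    linear_combination e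
  rw [aStar, ← h.sideC_zero]
  have e2 : (sideA la r 0)⁻¹ = 2 / lb - (sideC la r 0)⁻¹ := by
    rw [eq_sub_iff_add_eq, eq_div_iff hb.ne', e1]
  have e3 : 2 * sideC la r 0 / lb - 1 = sideC la r 0 * (sideA la r 0)⁻¹ := by
    rw [e2, mul_sub, mul_inv_cancel₀ hc.ne']
    ring
  rw [e3]
  field_simp

lemma sideB_zero (h : IsFamily la lb r) : sideB la r 0 = bStar la lb := by
  have e : cStar lb la = cStar la lb := by
    rw [cStar, cStar, add_comm lb la, add_comm (lb ^ 2), mul_comm lb la]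
  rw [← h.sideA_swap (by norm_num), h.swap.sideA_zero, aStar, bStar, e]

/-- At `s = 0` one has `c = a + b`, so the median is half of `|a - b|`; `la ≤ lb` gives `b ≤ a` and
removes the absolute value. -/
lemma medianC_zero (h : IsFamily la lb r) (hab : la ≤ lb) :
    medianOfSides (sideC la r 0) (sideA la r 0) (sideB la r 0) = mcStar la lb := by
  have i0 : (0 : ℝ) ∈ Ico (0 : ℝ) 1 := by norm_num
  have i0' : (0 : ℝ) ∈ Icc (0 : ℝ) 1 := by norm_num
  have h1 := h.inv_sideA_add_inv_sideC i0
  have h2 := h.swap.inv_sideA_add_inv_sideC i0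
  rw [h.sideA_swap i0', h.sideC_swap i0'] at h2
  have ha := h.sideA_pos i0
  have hb := h.sideB_pos i0
  have hc := inv_pos.2 (h.sideC_pos i0')
  have hle : sideB la r 0 ≤ sideA la r 0 := by
    refine (inv_le_inv₀ ha hb).1 (le_of_not_gt fun hlt => ?_)
    have p1 := inv_pos.2 ha
    have p2 := inv_pos.2 hb
    have l1 : ((sideB la r 0)⁻¹ + (sideC la r 0)⁻¹) ^ 2 <
        ((sideA la r 0)⁻¹ + (sideC la r 0)⁻¹) ^ 2 :=
      pow_lt_pow_left₀ (by linarith) (by positivity) two_ne_zero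
    have l2 : la ^ 2 ≤ lb ^ 2 := pow_le_pow_left₀ h.la_pos.le hab 2
    have := mul_lt_mul l1 l2 (pow_pos h.la_pos 2) (by positivity)
    linarith
  rw [mcStar, ← h.sideA_zero, ← h.sideB_zero]
  refine (eq_medianOfSides (by linarith) ?_).symm
  rw [← h.sideA_add_sideB_zero]
  ring

end IsFamily

end TwoBisectors

/-! ### Assembly of the six counts -/

theorem mainTheorem3 (la lb : ℝ) (hla : 0 < la) (hab : la ≤ lb) :
    ((∀ x : ℝ, TwoBisectors.hStarStar la lb < x ∧ x < la → TwoBisectors.ExactlyTwo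
        (TwoBisectors.trianglesWith la lb (fun T => T.height 0) x)) ∧
      (∀ x : ℝ, (0 < x ∧ x ≤ TwoBisectors.hStarStar la lb) ∨ x = la → TwoBisectors.ExactlyOne
        (TwoBisectors.trianglesWith la lb (fun T => T.height 0) x)) ∧
      (∀ x : ℝ, x ≤ 0 ∨ la < x →
        TwoBisectors.trianglesWith la lb (fun T => T.height 0) x = ∅)) ∧
    ((∀ x : ℝ, TwoBisectors.hStarStar la lb < x ∧ x < lb → TwoBisectors.ExactlyTwo
        (TwoBisectors.trianglesWith la lb (fun T => T.height 1) x)) ∧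
      (∀ x : ℝ, (0 < x ∧ x ≤ TwoBisectors.hStarStar la lb) ∨ x = lb → TwoBisectors.ExactlyOne
        (TwoBisectors.trianglesWith la lb (fun T => T.height 1) x)) ∧
      (∀ x : ℝ, x ≤ 0 ∨ lb < x →
        TwoBisectors.trianglesWith la lb (fun T => T.height 1) x = ∅)) ∧
    ((∀ x : ℝ, 0 < x → TwoBisectors.ExactlyOne
        (TwoBisectors.trianglesWith la lb (fun T => T.height 2) x)) ∧
      (∀ x : ℝ, x ≤ 0 →
        TwoBisectors.trianglesWith la lb (fun T => T.height 2) x = ∅)) ∧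
    ((∀ x : ℝ, la < x ∧ x < TwoBisectors.maStar la lb → TwoBisectors.ExactlyTwo
        (TwoBisectors.trianglesWith la lb (fun T => TwoBisectors.medianLength T 0) x)) ∧
      (∀ x : ℝ, TwoBisectors.maStar la lb ≤ x ∨ x = la → TwoBisectors.ExactlyOne
        (TwoBisectors.trianglesWith la lb (fun T => TwoBisectors.medianLength T 0) x)) ∧
      (∀ x : ℝ, x < la →
        TwoBisectors.trianglesWith la lb (fun T => TwoBisectors.medianLength T 0) x = ∅)) ∧
    ((∀ x : ℝ, lb < x ∧ x < TwoBisectors.mbStar la lb → TwoBisectors.ExactlyTwo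
        (TwoBisectors.trianglesWith la lb (fun T => TwoBisectors.medianLength T 1) x)) ∧
      (∀ x : ℝ, TwoBisectors.mbStar la lb ≤ x ∨ x = lb → TwoBisectors.ExactlyOne
        (TwoBisectors.trianglesWith la lb (fun T => TwoBisectors.medianLength T 1) x)) ∧
      (∀ x : ℝ, x < lb →
        TwoBisectors.trianglesWith la lb (fun T => TwoBisectors.medianLength T 1) x = ∅)) ∧
    ((∀ x : ℝ, TwoBisectors.mcStar la lb < x → TwoBisectors.ExactlyOne
        (TwoBisectors.trianglesWith la lb (fun T => TwoBisectors.medianLength T 2) x)) ∧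
      (∀ x : ℝ, x ≤ TwoBisectors.mcStar la lb →
        TwoBisectors.trianglesWith la lb (fun T => TwoBisectors.medianLength T 2) x = ∅)) := by
  have hlb : 0 < lb := hla.trans_le hab
  obtain ⟨r, h⟩ := TwoBisectors.exists_isFamily hla hlb
  have ha := h.heightCount
  have hb := h.swap.heightCount
  have hStar : TwoBisectors.hStarStar lb la = TwoBisectors.hStarStar la lb := by
    rw [TwoBisectors.hStarStar, TwoBisectors.hStarStar, mul_comm, add_comm]
  rw [hStar] at hb
  have ma := h.medianCount_sideA
  have mb := h.medianCount_sideB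
  rw [h.sideA_zero, h.sideB_zero] at ma mb
  refine ⟨⟨fun x hx => h.exactlyTwo h.realizes_height_zero (ha.two x hx.1 hx.2),
      fun x hx => h.exactlyOne h.realizes_height_zero (ha.one x hx),
      fun x hx => h.trianglesWith_eq_empty h.realizes_height_zero (ha.none x hx)⟩,
    ⟨fun x hx => h.exactlyTwo h.realizes_height_one (hb.two x hx.1 hx.2),
      fun x hx => h.exactlyOne h.realizes_height_one (hb.one x hx),
      fun x hx => h.trianglesWith_eq_empty h.realizes_height_one (hb.none x hx)⟩,
    ⟨fun x hx => h.exactlyOne h.realizes_height_two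
        (TwoBisectors.exists_unique_root_of_strictMonoOn h.continuousOn_heightC
          (h.strictMonoOn_heightC hab) (TwoBisectors.IsFamily.heightC_zero.trans_lt hx)
          (h.exists_lt_heightC hab x)),
      fun x hx => h.trianglesWith_eq_empty h.realizes_height_two fun s hs hsx => ?_⟩,
    ⟨fun x hx => h.exactlyTwo TwoBisectors.IsFamily.realizes_median_zero (ma.two x hx.1 hx.2),
      fun x hx => h.exactlyOne TwoBisectors.IsFamily.realizes_median_zero (ma.one x hx),
      fun x hx => h.trianglesWith_eq_empty TwoBisectors.IsFamily.realizes_median_zero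
        (ma.none x hx)⟩,
    ⟨fun x hx => h.exactlyTwo TwoBisectors.IsFamily.realizes_median_one (mb.two x hx.1 hx.2),
      fun x hx => h.exactlyOne TwoBisectors.IsFamily.realizes_median_one (mb.one x hx),
      fun x hx => h.trianglesWith_eq_empty TwoBisectors.IsFamily.realizes_median_one
        (mb.none x hx)⟩,
    ⟨fun x hx => h.exactlyOne TwoBisectors.IsFamily.realizes_median_two
        (TwoBisectors.exists_unique_root_of_strictMonoOn h.continuousOn_medianC
          h.strictMonoOn_medianC ((h.medianC_zero hab).trans_lt hx) (h.exists_lt_medianC x)),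
      fun x hx => h.trianglesWith_eq_empty TwoBisectors.IsFamily.realizes_median_two
        fun s hs hsx => ?_⟩⟩
  · have h1 := h.strictMonoOn_heightC hab (by norm_num) (Ioo_subset_Ico_self hs) hs.1
    rw [TwoBisectors.IsFamily.heightC_zero] at h1
    linarith
  · have h1 := h.strictMonoOn_medianC (by norm_num) (Ioo_subset_Ico_self hs) hs.1
    simp only [h.medianC_zero hab] at h1 hsx
    linarith
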